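/- Graphs are finite connected multigraphs $G=(V,E,l)$ without self-loops, with $n$ vertices and edge lengths $l(e)\ge 1$; $\log$ is to base $2$. For an edge set $A$, $G/A$ is the quotient multigraph whose vertices are the connected components of $(V,A)$. *Partition.* A randomized routine $\textsc{Partition}(H,d)$, $d>0$, on finite loopless multigraphs $H$ (not necessarily connected) with positive edge lengths satisfies the partition guarantee with constant $C$ if it returns a partition of $V(H)$, each piece with a spanning tree that is a shortest path tree of the subgraph induced on the piece, such that, with $n_H=|V(H)|$: (i) except with probability at most $n_H^{-k}$ (for some fixed $k$) all these trees have diameter at most $d$; (ii) the ends of any edge $e$ lie in different pieces with probability at most $C\,l(e)\log n_H/d$. Different calls use independent randomness. *$\textsc{AKPW}(G,\delta)$.* Let $E_i$ be the set of edges with length in $[\delta^i,\delta^{i+1})$; $A_0=\emptyset$, $s=0$. While $A_s$ is not a spanning tree of $G$: let $G_s$ be the graph $G/A_s$ with only those edges of $E_0\cup\dots\cup E_s$ that join different components of $A_s$, with unit lengths; let $A_{s+1}$ be $A_s$ together with the trees returned by $\textsc{Partition}(G_s,\delta/3)$; increase $s$. Return $\mathcal A=(A_0,\dots,A_s)$.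 Put $A_j=\emptyset$ for $j<0$ and $A_j=A_s$ for $j>s$. *$\textsc{DecomposeTwoStage}(G,\mathbf d,\mathcal A)$*, for a sequence $\mathbf d=(d_0>d_1>\dots>d_t>0)$ and $0<q<1$. Let $\mathrm{scope}(i)=\max\{j\in\mathbb Z:\delta^{\,j+\frac1{1-q}+1}\le d_i\}$. Put $B_0=A_s$. For $i=1,\dots,t$: form $G'$ from the subgraphs of $G$ induced by the connected components of $B_{i-1}$ by contracting $A_{\mathrm{scope}(i)}$ (discarding self-loops), increase all edge lengths to at least $\delta^{\mathrm{scope}(i)+1}$, and remove the edges whose length is then at least $d_i/\log n$; call $\textsc{Partition}(H,d_i/3)$ on every connected component $H$ of $G'$; let $B_i$ be $A_{\mathrm{scope}(i)}$ together with all trees returned. Return $\mathcal B=(B_0,\dots,B_t)$. An edge is *first cut at level $i$* ($0\le i<t$) if its ends are connected in $B_i$ but not in $B_{i+1}$; it is then *cut in pass $i+1$*. Its $\ell_p$-stretch is $\mathrm{str}^p_{\mathcal B,\mathbf d}(e)=(d_i/l(e))^p$ if it is first cut at level $i$. **Statement.** For every $k$ there is a constant $C$ for which a routine Partition with the above guarantee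 exists. Moreover, for every $C>0$ there is a constant $c\ge1$, depending only on $C$, such that the following holds for every Partition routine with constant $C$ (and any $k$), every $G$ as above, every edge $e$ of $G$, and every $\delta\ge(c\log n)^{1/(1-q)}$, where $\mathcal A=\textsc{AKPW}(G,\delta)$ and $\mathcal B=\textsc{DecomposeTwoStage}(G,\mathbf d,\mathcal A)$, with probability over both procedures. 1. For $0<q<1$ and every decreasing positive $\mathbf d$, $\textsc{AKPW}$ terminates almost surely, and for $1\le i\le t$ $$\Pr[e\text{ is cut in pass }i]\le K\left(\frac{l(e)\log n}{d_i}\right)^q,$$ with $K$ depending only on $C$. 2. Let $0<p<1$, $q=\frac{1+p}2$, $t\ge1$, $d_t<1$, and suppose $d_{i+1}\le\gamma d_i$ for all $i<t$, where $0<\gamma<1$. Then almost surely $e$ is cut in some pass; with $I$ the (first) such pass, $$\mathbb E\left[\left(\frac{d_I}{l(e)}\right)^p\right]\le\frac{K'}{1-p}\log^p n,$$ with $K'$ depending only on $C,\gamma$. 3. If $\rho d_i\le d_{i+1}\le\gamma d_i$ for all $i<t$, where $\rho>0$ and $0<\gamma<1$, then for $0<q<1$ and $i<t$ $$\Pr[e\text{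 is first cut at level }i]\le K''\left(\frac{l(e)\log n}{d_i}\right)^q,$$ and, if $0<p<1$, $q=\frac{1+p}2$, $t\ge1$ and $d_t<1$, $$\mathbb E_{\mathcal B}\left[\mathrm{str}^p_{\mathcal B,\mathbf d}(e)\right]\le\frac{K''}{1-p}\log^p n,$$ with $K''$ depending only on $C,\gamma,\rho$. -/

import Mathlib

open scoped ENNReal

universe u v

noncomputable section

namespace TwoStage

variable {α : Type u} {β : Type v}

/-! ### Lengths, distances and components in multigraphs

A multigraph is a `Graph α β`; edge lengths are a function `l : β → ℝ`; a subgraph with the same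
vertices (a forest `A_i` or `B_i`) is given by its set of edges. -/

/-- `HasWalk G l x y r`: there is a walk of total length `r` from `x` to `y` in `G`. -/
inductive HasWalk (G : Graph α β) (l : β → ℝ) : α → α → ℝ → Prop
  | nil (x : α) : HasWalk G l x x 0
  | cons {e : β} {x y z : α} {r : ℝ} :
      G.IsLink e x y → HasWalk G l y z r → HasWalk G l x z (l e + r)

/-- The distance between two vertices, `∞` if they are not connected. -/
def gdist (G : Graph α β) (l : β → ℝ) (x y : α) : ℝ≥0∞ :=
  ⨅ (r : ℝ) (_ : HasWalk G l x y r), ENNReal.ofReal r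

/-- `x` and `y` are connected by a path of `G`. -/
def Conn (G : Graph α β) (x y : α) : Prop := Relation.ReflTransGen G.Adj x y

/-- The vertex set of the connected component of `x`. -/
def comp (G : Graph α β) (x : α) : Set α := {y | Conn G x y}

/-- The ends of the edge `e` of `G` are connected by the edges in `A`. -/
def Joined (G : Graph α β) (A : Set β) (e : β) : Prop :=
  ∃ x y, G.IsLink e x y ∧ Conn (G.restrict A) x y

/-- The edge set `F` is a forest: it consists of edges of `H`, and each of them is a bridge. -/
def IsForest (H : Graph α β) (F : Set β) : Prop :=
  F ⊆ H.edgeSet ∧ ∀ e ∈ F, ¬ Joined H (F \ {e}) e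

/-- Each tree of the forest `F` is a shortest path tree of the subgraph of `H` induced by the
vertices of that tree. -/
def IsShortestPathForest (H : Graph α β) (l : β → ℝ) (F : Set β) : Prop :=
  IsForest H F ∧ ∀ x ∈ H.vertexSet, ∃ r ∈ comp (H.restrict F) x,
    ∀ y ∈ comp (H.restrict F) x,
      gdist (H.restrict F) l r y = gdist (H.induce (comp (H.restrict F) x)) l r y

/-- Every tree of the forest `F` has diameter at most `d`. -/
def DiamLE (H : Graph α β) (l : β → ℝ) (F : Set β) (d : ℝ) : Prop :=
  ∀ x ∈ H.vertexSet, ∀ y ∈ comp (H.restrict F) x,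
    gdist (H.restrict F) l x y ≤ ENNReal.ofReal d

/-- `log n`, to base two, for `n` the number of vertices. -/
def logn (G : Graph α β) : ℝ := Real.logb 2 (G.vertexSet.ncard : ℝ)

/-! ### The low-diameter decomposition routine -/

/-- A randomized routine that takes a multigraph, edge lengths and a diameter parameter, and returns
a partition of the vertex set, in the form of a forest with one spanning tree for each piece. -/
abbrev PartitionRoutine (α : Type u) (β : Type v) : Type (max u v) :=
  Graph α β → (β → ℝ) → ℝ → PMF (Set β)

/-- The contract of the routine Partition, with constant `C` for the cut probabilities and exponent
`k` for "with high probability": the pieces are spanned by shortest path trees, which have diameter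
at most `d` except with probability at most `n ^ (-k)`, and the ends of an edge `e` are in
different pieces with probability at most `C * l e * log n / d`. -/
structure IsPartitionRoutine (C : ℝ) (k : ℕ) (P : PartitionRoutine α β) : Prop where
  forest : ∀ (H : Graph α β) (l : β → ℝ) (d : ℝ), H.Loopless → (∀ e ∈ H.edgeSet, 0 < l e) → 0 < d →
    ∀ F ∈ (P H l d).support, IsShortestPathForest H l F
  diam : ∀ (H : Graph α β) (l : β → ℝ) (d : ℝ), H.Loopless → (∀ e ∈ H.edgeSet, 0 < l e) → 0 < d →
    (P H l d).toOuterMeasure {F | ¬ DiamLE H l F d} ≤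
      ENNReal.ofReal (1 / (H.vertexSet.ncard : ℝ) ^ k)
  cut : ∀ (H : Graph α β) (l : β → ℝ) (d : ℝ), H.Loopless → (∀ e ∈ H.edgeSet, 0 < l e) → 0 < d →
    ∀ e ∈ H.edgeSet, (P H l d).toOuterMeasure {F | ¬ Joined H F e} ≤
      ENNReal.ofReal (C * l e * logn H / d)

/-! ### Quotient graphs -/

/-- The quotient graph `G / A`: its vertices are the connected components of `A` (as sets of vertices
of `G`), and every edge of `G` is kept, with its ends relabelled accordingly. -/
def contract (G : Graph α β) (A : Set β) : Graph (Set α) β := G.map (comp (G.restrict A))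

/-! ### The output law of a randomized loop -/

/-- The law of the state after `N` rounds of `while not halt do x ← step x`. -/
def loopRun {σ : Type*} (halt : σ → Prop) (step : σ → PMF σ) (x₀ : σ) : ℕ → PMF σ
  | 0 => PMF.pure x₀
  | N + 1 => (loopRun halt step x₀ N).bind fun x =>
      open Classical in if halt x then PMF.pure x else step x

/-- The law of the output of the loop: the probability that it stops with output `y`. The total mass
is the probability that the loop stops at all. -/
def loopLaw {σ : Type*} (halt : σ → Prop) (step : σ → PMF σ) (x₀ y : σ) : ℝ≥0∞ :=
  ⨆ N : ℕ, open Classical in if halt y then loopRun halt step x₀ N y else 0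

/-- The probability of the event `S` under the law with masses `μ`. -/
def prob {σ : Type*} (μ : σ → ℝ≥0∞) (S : Set σ) : ℝ≥0∞ := ∑' x, S.indicator μ x

/-- The expectation of `f` under the law with masses `μ`. -/
def expect {σ : Type*} (μ : σ → ℝ≥0∞) (f : σ → ℝ≥0∞) : ℝ≥0∞ := ∑' x, μ x * f x

/-! ### The procedure AKPW

A run is the list `[A_0, ..., A_s]` of the edge sets built so far. -/

/-- The bucket `E_i` of the edges of length in `[δ^i, δ^(i+1))`. -/
def bucket (G : Graph α β) (l : β → ℝ) (δ : ℝ) (i : ℕ) : Set β :=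
  {e ∈ G.edgeSet | δ ^ i ≤ l e ∧ l e < δ ^ (i + 1)}

/-- The graph `G_s`: the edges of `E_0, ..., E_s` between different components of `A`, in `G / A`. -/
def akpwGraph (G : Graph α β) (l : β → ℝ) (δ : ℝ) (s : ℕ) (A : Set β) : Graph (Set α) β :=
  (contract G A).restrict {e | (∃ i ≤ s, e ∈ bucket G l δ i) ∧ ¬ Joined G A e}

/-- One round: `A_{s+1}` is `A_s` together with the trees that `Partition(G_s, δ/3)`, called with
unit lengths, returns. -/
def akpwStep (P : PartitionRoutine (Set α) β) (G : Graph α β) (l : β → ℝ) (δ : ℝ)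
    (𝒜 : List (Set β)) : PMF (List (Set β)) :=
  (P (akpwGraph G l δ (𝒜.length - 1) (𝒜.getLastD ∅)) (fun _ => 1) (δ / 3)).map
    fun T => 𝒜 ++ [𝒜.getLastD ∅ ∪ T]

/-- The last set of the run connects all vertices of `G`. Since it is a forest, this says that it is
a spanning tree. -/
def akpwDone (G : Graph α β) (𝒜 : List (Set β)) : Prop :=
  ∀ x ∈ G.vertexSet, ∀ y ∈ G.vertexSet, Conn (G.restrict (𝒜.getLastD ∅)) x y

/-- The law of the output `(A_0, ..., A_s)` of `AKPW(G, δ)`. -/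
def akpwLaw (P : PartitionRoutine (Set α) β) (G : Graph α β) (l : β → ℝ) (δ : ℝ) :
    List (Set β) → ℝ≥0∞ :=
  loopLaw (akpwDone G) (akpwStep P G l δ) [∅]

/-- `A_k` for any integer `k`: empty for `k < 0`, and `A_s` for `k > s`. -/
def akpwLevel (𝒜 : List (Set β)) (k : ℤ) : Set β :=
  if k < 0 then ∅ else 𝒜.getD k.toNat (𝒜.getLastD ∅)

/-! ### The procedure DecomposeTwoStage -/

/-- The scope of a diameter `D`: the largest integer `j` with `δ^(j + 1/(1-q) + 1) ≤ D`. -/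
def scope (q δ D : ℝ) : ℤ := sSup {j : ℤ | δ ^ ((j : ℝ) + 1 / (1 - q) + 1) ≤ D}

/-- The edge lengths in a pass with scope `k`: increased to at least `δ^(k+1)`. -/
def raised (l : β → ℝ) (δ : ℝ) (k : ℤ) (e : β) : ℝ := max (l e) (δ ^ (k + 1))

/-- The graph `G'` of a pass with scope `k` and diameter `D`: the subgraphs of `G` induced by the
connected components of the previous forest `B` are contracted along `A`, and the edges whose
raised length is at least `D / log n` are removed. -/
def passGraph (G : Graph α β) (l : β → ℝ) (δ : ℝ) (A B : Set β) (k : ℤ) (D : ℝ) :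
    Graph (Set α) β :=
  (contract G A).restrict
    {e | Joined G B e ∧ ¬ Joined G A e ∧ raised l δ k e < D / logn G}

/-- The vertex sets of the connected components of `H`, in some order. -/
def components [Finite α] (H : Graph α β) : List (Set α) :=
  (Set.toFinite (comp H '' H.vertexSet)).toFinset.toList

/-- Call `P` separately on every connected component of `H`, with fresh randomness, and collect the
trees. -/
def partitionAll [Finite α] (P : PartitionRoutine α β) (H : Graph α β) (l : β → ℝ) (d : ℝ) :
    PMF (Set β) :=
  (components H).foldr
    (fun X law => law.bind fun F => (P (H.induce X) l d).map fun T => F ∪ T) (PMF.pure ∅)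

/-- One pass: the next forest, given the AKPW decomposition, the previous forest `B` and the
diameter `D`. -/
def pass [Finite α] (P : PartitionRoutine (Set α) β) (G : Graph α β) (l : β → ℝ) (q δ : ℝ)
    (𝒜 : List (Set β)) (B : Set β) (D : ℝ) : PMF (Set β) :=
  (partitionAll P
    (passGraph G l δ (akpwLevel 𝒜 (scope q δ D)) B (scope q δ D) D)
    (raised l δ (scope q δ D)) (D / 3)).map fun F => akpwLevel 𝒜 (scope q δ D) ∪ F

/-- The law of `(B_0, ..., B_t)` (extended by empty sets) for a fixed AKPW decomposition. -/
def twoStage [Finite α] (P : PartitionRoutine (Set α) β) (G : Graph α β) (l : β → ℝ) (q δ : ℝ)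
    (d : ℕ → ℝ) (𝒜 : List (Set β)) : ℕ → PMF (ℕ → Set β)
  | 0 => PMF.pure (Function.update (fun _ => ∅) 0 (𝒜.getLastD ∅))
  | i + 1 => (twoStage P G l q δ d 𝒜 i).bind fun ℬ =>
      (pass P G l q δ 𝒜 (ℬ i) (d (i + 1))).map fun F => Function.update ℬ (i + 1) F

/-- The law of `DecomposeTwoStage(G, d, AKPW(G, δ))`, over the randomness of both procedures. -/
def decomposeLaw [Finite α] (P : PartitionRoutine (Set α) β) (G : Graph α β) (l : β → ℝ)
    (q δ : ℝ) (d : ℕ → ℝ) (t : ℕ) (ℬ : ℕ → Set β) : ℝ≥0∞ :=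
  ∑' 𝒜 : List (Set β), akpwLaw P G l δ 𝒜 * twoStage P G l q δ d 𝒜 t ℬ

/-! ### Cuts and stretch -/

/-- `e` is first cut at level `i`: its ends are connected in `B_i` and not in `B_{i+1}`. In other
words, `e` is cut in the pass `i + 1`, which partitions into pieces of diameter `d_{i+1}`. -/
def FirstCutAt (G : Graph α β) (ℬ : ℕ → Set β) (i : ℕ) (e : β) : Prop :=
  Joined G (ℬ i) e ∧ ¬ Joined G (ℬ (i + 1)) e

/-- The `ℓ_p`-stretch `(D_i / l(e))^p` of an edge first cut at level `i < t`. It is `∞` if the edge is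
never cut, so that no bound on an expectation can hold for an empty reason. -/
def stretch (G : Graph α β) (l : β → ℝ) (p : ℝ) (D : ℕ → ℝ) (t : ℕ) (ℬ : ℕ → Set β) (e : β) :
    ℝ≥0∞ :=
  open Classical in
  if h : ∃ i, i < t ∧ FirstCutAt G ℬ i e then ENNReal.ofReal ((D (Nat.find h) / l e) ^ p) else ⊤

/-! ### Inputs -/

/-- A connected multigraph without self-loops, all of whose edges have length at least one. -/
structure IsInput (G : Graph α β) (l : β → ℝ) : Prop where
  loopless : G.Loopless
  connected : ∀ x ∈ G.vertexSet, ∀ y ∈ G.vertexSet, Conn G x y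
  one_le : ∀ e ∈ G.edgeSet, 1 ≤ l e

/-- `d_0 > d_1 > ... > d_t > 0`. -/
def IsDiamSeq (d : ℕ → ℝ) (t : ℕ) : Prop :=
  (∀ i ≤ t, 0 < d i) ∧ ∀ i < t, d (i + 1) < d i

end TwoStage

end

/-!
The existence of Partition is proved by sequential ball carving (`carve`): balls about the vertices
are removed one after the other, each taken in the graph left by the previous ones, with independent
radii that are geometric multiples of a small unit. Whichever ball first reaches an edge contains
both of its ends unless its radius stops within the length of the edge, and since the geometric law
is memoryless this has probability proportional to the length (`carve_cut_le`). With mean radius of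
order `d / (k log n)`, all radii are at most `d / 2` except with probability `n ^ (-k)`. Every ball
is then spanned by a tree of last edges of shortest paths from its centre
(`IsCentreMap.exists_forest`).

For the decomposition, let `e` be an edge with length in `[δ ^ b, δ ^ (b + 1))`. From round `b` on,
each round of AKPW fails to join its ends with probability at most `3 C log n / δ ≤ δ ^ (-q)`, the
inequality being the lower bound on `δ`. Hence AKPW terminates almost surely (`tsum_akpwLaw`), and
`A_j` leaves `e` separated with probability at most `δ ^ (-q (j - b))` (`prob_akpwLevel_le`). A pass
of diameter `D` and scope `j` can cut `e` only if `A_j` does not join its ends, and then cuts it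
with probability at most `3 C log n / D` times the raised length (`pass_cut_le`). If `e` is longer
than `δ ^ (j + 1)`, its length is not raised and the trivial bound `min 1 x ≤ x ^ q` suffices. If
not, the definition of the scope says precisely that the factor gained in the first stage makes up
for raising the length to `δ ^ (j + 1)` (`scope_tradeoff`). In both cases the probability is
`O((l e log n / D) ^ q)` (`prob_firstCutAt_le`).

For the stretch, passes of diameter at most `l e log n` contribute at most `log ^ p n` together,
because `e` is charged only once, and the larger ones contribute
`O(log ^ p n) ∑ (l e log n / d_i) ^ (q - p)`, a geometric sum with value `O(1 / (1 - p))`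
(`expect_stretch_le`). The edge is cut almost surely: AKPW ends with a connected graph, and in the
pass of diameter less than one all edges are too long to be kept, so that its forest is empty
(`exists_firstCutAt`). Bounds with respect to `d_i` instead of `d_{i+1}` lose a factor
`max 1 (1 / ρ)`.
-/

noncomputable section

namespace TwoStage

/-! ### Walks, distances and connectivity -/

section Walks

variable {α : Type*} {β : Type*} {G H : Graph α β} {l : β → ℝ} {x y z : α} {r s : ℝ} {e : β}

theorem HasWalk.append (h : HasWalk G l x y r) (h' : HasWalk G l y z s) :
    HasWalk G l x z (r + s) := by
  induction h with
  | nil => simpa using h'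
  | cons he _ ih => simpa [add_assoc] using HasWalk.cons he (ih h')

theorem HasWalk.single (h : G.IsLink e x y) : HasWalk G l x y (l e) := by
  simpa using HasWalk.cons (l := l) h (HasWalk.nil y)

theorem HasWalk.reverse (h : HasWalk G l x y r) : HasWalk G l y x r := by
  induction h with
  | nil => exact HasWalk.nil _
  | cons he _ ih => simpa [add_comm] using ih.append (HasWalk.single he.symm)

theorem HasWalk.mono (hGH : ∀ ⦃e x y⦄, G.IsLink e x y → H.IsLink e x y)
    (h : HasWalk G l x y r) : HasWalk H l x y r := by
  induction h with
  | nil => exact HasWalk.nil _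
  | cons he _ ih => exact HasWalk.cons (hGH he) ih

theorem HasWalk.nonneg (hl : ∀ e ∈ G.edgeSet, 0 < l e) (h : HasWalk G l x y r) : 0 ≤ r := by
  induction h with
  | nil => exact le_rfl
  | cons he _ ih => exact add_nonneg (hl _ he.edge_mem).le ih

theorem HasWalk.conn (h : HasWalk G l x y r) : Conn G x y := by
  induction h with
  | nil => exact .refl
  | cons he _ ih => exact .head ⟨_, he⟩ ih

theorem Conn.exists_hasWalk (l : β → ℝ) (h : Conn G x y) : ∃ r, HasWalk G l x y r := by
  induction h with
  | refl => exact ⟨0, HasWalk.nil _⟩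
  | tail _ h ih =>
    obtain ⟨r, hr⟩ := ih
    obtain ⟨e, he⟩ := h
    exact ⟨_, hr.append (HasWalk.single he)⟩

theorem Conn.symm (h : Conn G x y) : Conn G y x := by
  obtain ⟨r, hr⟩ := h.exists_hasWalk (fun _ => 0)
  exact hr.reverse.conn

theorem Conn.mono (hGH : ∀ ⦃e x y⦄, G.IsLink e x y → H.IsLink e x y) (h : Conn G x y) :
    Conn H x y :=
  Relation.ReflTransGen.mono (show G.Adj ≤ H.Adj from fun _ _ ⟨e, he⟩ => ⟨e, hGH he⟩) _ _ h

theorem Conn.restrict_mono {A B : Set β} (hAB : A ⊆ B) (h : Conn (G.restrict A) x y) :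
    Conn (G.restrict B) x y :=
  Conn.mono (G := G.restrict A) (H := G.restrict B) (fun _ _ _ he => ⟨hAB he.1, he.2⟩) h

theorem Joined.mono {A B : Set β} (hAB : A ⊆ B) (h : Joined G A e) : Joined G B e := by
  obtain ⟨x, y, he, hc⟩ := h
  exact ⟨x, y, he, hc.restrict_mono hAB⟩

theorem joined_iff_conn {A : Set β} (h : G.IsLink e x y) :
    Joined G A e ↔ Conn (G.restrict A) x y := by
  refine ⟨?_, fun hc => ⟨x, y, h, hc⟩⟩
  rintro ⟨x', y', h', hc⟩
  obtain ⟨rfl, rfl⟩ | ⟨rfl, rfl⟩ := h.eq_and_eq_or_eq_and_eq h'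
  exacts [hc, hc.symm]

/-- A set of vertices that no edge leaves contains the component of each of its vertices. -/
theorem Conn.mem_of_closed {S : Set α} (hS : ∀ ⦃e a b⦄, G.IsLink e a b → a ∈ S → b ∈ S)
    (h : Conn G x y) (hx : x ∈ S) : y ∈ S := by
  induction h with
  | refl => exact hx
  | tail _ h ih => exact h.elim fun e he => hS he ih

theorem Conn.comp_eq (h : Conn G x y) : comp G x = comp G y :=
  Set.ext fun _ => ⟨fun hz => h.symm.trans hz, fun hz => h.trans hz⟩

theorem comp_eq_iff_conn : comp G x = comp G y ↔ Conn G x y :=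
  ⟨fun h => show y ∈ comp G x from h ▸ (Relation.ReflTransGen.refl : Conn G y y), Conn.comp_eq⟩

theorem comp_subset_vertexSet (hx : x ∈ G.vertexSet) : comp G x ⊆ G.vertexSet :=
  fun _ hy => Conn.mem_of_closed (fun _ _ _ h _ => h.right_mem) hy hx

theorem HasWalk.gdist_le (h : HasWalk G l x y r) : gdist G l x y ≤ ENNReal.ofReal r :=
  iInf₂_le r h

@[simp] theorem gdist_self (x : α) : gdist G l x x = 0 := by
  simpa using (HasWalk.nil (G := G) (l := l) x).gdist_le

theorem gdist_comm : gdist G l x y = gdist G l y x :=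
  le_antisymm (le_iInf₂ fun _ hr => hr.reverse.gdist_le) (le_iInf₂ fun _ hr => hr.reverse.gdist_le)

theorem gdist_triangle (x y z : α) : gdist G l x z ≤ gdist G l x y + gdist G l y z := by
  refine ENNReal.le_iInf₂_add_iInf₂ fun r hr s hs =>
    ((hr.append hs).gdist_le).trans ENNReal.ofReal_add_le

theorem gdist_le_of_isLink (h : G.IsLink e x y) : gdist G l x y ≤ ENNReal.ofReal (l e) :=
  (HasWalk.single h).gdist_le

theorem conn_of_gdist_lt_top (h : gdist G l x y < ⊤) : Conn G x y := by
  simp only [gdist, iInf_lt_iff] at h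
  obtain ⟨r, hr, -⟩ := h
  exact hr.conn

theorem HasWalk.exists_last (h : HasWalk G l x y r) (hxy : x ≠ y) :
    ∃ e z s, G.IsLink e z y ∧ HasWalk G l x z s ∧ r = s + l e := by
  cases h.reverse with
  | nil => exact absurd rfl hxy
  | @cons e _ z _ s he h' => exact ⟨e, z, s, he.symm, h'.reverse, add_comm _ _⟩

theorem HasWalk.induce {S : Set α} (hS : ∀ ⦃e a b⦄, G.IsLink e a b → a ∈ S → b ∈ S)
    (h : HasWalk G l x y r) (hx : x ∈ S) : HasWalk (G.induce S) l x y r := by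
  induction h with
  | nil => exact HasWalk.nil _
  | cons he _ ih => exact HasWalk.cons ⟨he, hx, hS he hx⟩ (ih (hS he hx))

/-- On a finite graph a vertex `y` at finite distance from `x` has a neighbour through which a
shortest path from `x` reaches `y`; as there are finitely many last edges to choose from, no
appeal to simple paths is needed. -/
theorem exists_parent [Finite α] [Finite β] (hl : ∀ e ∈ G.edgeSet, 0 < l e) (hxy : x ≠ y)
    (hfin : gdist G l x y < ⊤) :
    ∃ e z, G.IsLink e z y ∧ gdist G l x z + ENNReal.ofReal (l e) ≤ gdist G l x y := by
  obtain ⟨r, hr⟩ := (conn_of_gdist_lt_top hfin).exists_hasWalk l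
  obtain ⟨e₀, z₀, -, h₀, -, -⟩ := hr.exists_last hxy
  obtain ⟨⟨e, z⟩, he, hmin⟩ := Set.exists_min_image {a : β × α | G.IsLink a.1 a.2 y}
    (fun a => gdist G l x a.2 + ENNReal.ofReal (l a.1)) (Set.toFinite _) ⟨(e₀, z₀), h₀⟩
  refine ⟨e, z, he, le_iInf₂ fun t ht => ?_⟩
  obtain ⟨e', z', s, he', hs, rfl⟩ := ht.exists_last hxy
  rw [ENNReal.ofReal_add (hs.nonneg hl) (hl _ he'.edge_mem).le]
  exact (hmin (e', z') he').trans (by gcongr; exact hs.gdist_le)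

theorem exists_parent_lt [Finite α] [Finite β] (hl : ∀ e ∈ G.edgeSet, 0 < l e) (hxy : x ≠ y)
    (hfin : gdist G l x y < ⊤) :
    ∃ e z, G.IsLink e z y ∧ gdist G l x z + ENNReal.ofReal (l e) ≤ gdist G l x y ∧
      gdist G l x z < gdist G l x y := by
  obtain ⟨e, z, he, h⟩ := exists_parent hl hxy hfin
  refine ⟨e, z, he, h, lt_of_lt_of_le ?_ h⟩
  have hz : gdist G l x z ≠ ⊤ := ne_top_of_le_ne_top hfin.ne (le_self_add.trans h)
  exact ENNReal.lt_add_right hz (by simpa using hl _ he.edge_mem)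

end Walks

/-! ### Shortest path forests from centre maps -/

section Forest

variable {α : Type*} {β : Type*}

/-- A partition of the vertex set `S` into pieces, given by the map `c` which sends a vertex to the
centre of its piece, such that in the graph induced by its piece every vertex is at distance at most
`B` from the centre. -/
structure IsCentreMap (H : Graph α β) (l : β → ℝ) (S : Set α) (c : α → α) (B : ℝ≥0∞) : Prop where
  mem : ∀ y ∈ S, c y ∈ S
  idem : ∀ y ∈ S, c (c y) = c y
  dist : ∀ y ∈ S, gdist (H.induce {z ∈ S | c z = c y}) l (c y) y ≤ B

/-- The pieces of a centre map are spanned by a forest of shortest path trees. Every vertex `y`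
other than a centre contributes the last edge `ε y` of a shortest path to it, from its parent `π y`.
The edge `ε y` is a bridge because no other edge `ε w` leaves the set of descendants of `y`. -/
theorem IsCentreMap.exists_forest [Finite α] [Finite β] {H : Graph α β} {l : β → ℝ} {c : α → α}
    {B : ℝ≥0∞} (hl : ∀ e ∈ H.edgeSet, 0 < l e) (hc : IsCentreMap H l H.vertexSet c B)
    (hB : B < ⊤) :
    ∃ F, IsShortestPathForest H l F ∧
      (∀ y ∈ H.vertexSet, comp (H.restrict F) y = {z ∈ H.vertexSet | c z = c y}) ∧
      ∀ y ∈ H.vertexSet, gdist (H.restrict F) l (c y) y =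
        gdist (H.induce {z ∈ H.vertexSet | c z = c y}) l (c y) y := by
  set V := H.vertexSet with hV
  let X : α → Set α := fun y => {z ∈ V | c z = c y}
  let D : α → ℝ≥0∞ := fun y => gdist (H.induce (X y)) l (c y) y
  have hXeq : ∀ {y z}, c z = c y → X z = X y := fun h => by simp only [X, h]
  have hD : ∀ {y z}, c z = c y → gdist (H.induce (X y)) l (c y) z = D z := fun h => by
    simp only [D, X, h]
  have hpar : ∀ y : {y // y ∈ V ∧ c y ≠ y}, ∃ e z, H.IsLink e z y ∧ z ∈ V ∧ c z = c y ∧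
      D z + ENNReal.ofReal (l e) ≤ D y ∧ D z < D y := by
    rintro ⟨y, hy, hne⟩
    obtain ⟨e, z, he, h1, h2⟩ := exists_parent_lt (G := H.induce (X y))
      (fun e he => by obtain ⟨_, _, h, -⟩ := he; exact hl e h.edge_mem) hne
      ((hc.dist y hy).trans_lt hB)
    have hz : c z = c y := he.2.1.2
    rw [hD hz] at h1 h2
    exact ⟨e, z, he.1, he.2.1.1, hz, h1, h2⟩
  choose ε π hlink hπV hπc hle hlt using hpar
  let F : Set β := Set.range ε
  -- forest edges stay within a piece
  have hFc : ∀ ⦃e a b⦄, (H.restrict F).IsLink e a b → c a = c b := by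
    rintro _ a b ⟨⟨w, rfl⟩, hab⟩
    obtain ⟨rfl, rfl⟩ | ⟨rfl, rfl⟩ := hab.eq_and_eq_or_eq_and_eq (hlink w)
    exacts [hπc w, (hπc w).symm]
  have hclosed : ∀ y, ∀ ⦃e a b⦄, (H.restrict F).IsLink e a b → a ∈ X y → b ∈ X y :=
    fun y e a b h ha => ⟨h.2.right_mem, (hFc h).symm.trans ha.2⟩
  have hcX : ∀ y ∈ V, c y ∈ X y := fun y hy => ⟨hc.mem y hy, hc.idem y hy⟩
  have hup : ∀ y ∈ V, gdist (H.restrict F) l (c y) y ≤ D y := by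
    have hwf : WellFounded (InvImage (· < ·) D) := Finite.wellFounded_of_trans_of_irrefl _
    intro y
    induction y using hwf.induction with
    | _ y ih =>
      intro hy
      by_cases hne : c y = y
      · rw [hne, gdist_self]; exact zero_le
      · let w : {y // y ∈ V ∧ c y ≠ y} := ⟨y, hy, hne⟩
        calc gdist (H.restrict F) l (c y) y
            ≤ gdist (H.restrict F) l (c y) (π w) + gdist (H.restrict F) l (π w) y :=
              gdist_triangle _ _ _
          _ ≤ D (π w) + ENNReal.ofReal (l (ε w)) := by
              gcongr
              · have := ih (π w) (hlt w) (hπV w)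
                rwa [hπc w] at this
              · exact gdist_le_of_isLink ⟨⟨w, rfl⟩, hlink w⟩
          _ ≤ D y := hle w
  have hdist : ∀ y ∈ V, gdist (H.restrict F) l (c y) y = D y := fun y hy =>
    (hup y hy).antisymm <| le_iInf₂ fun r hr =>
      (HasWalk.mono (G := (H.restrict F).induce (X y)) (H := H.induce (X y))
        (fun _ _ _ h => ⟨h.1.2, h.2⟩) (hr.induce (hclosed y) (hcX y hy))).gdist_le
  have hconn : ∀ y ∈ V, Conn (H.restrict F) (c y) y := fun y hy =>
    conn_of_gdist_lt_top ((hup y hy).trans_lt ((hc.dist y hy).trans_lt hB))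
  have hcomp : ∀ y ∈ V, comp (H.restrict F) y = X y := fun y hy => Set.ext fun z =>
    ⟨fun hz => Conn.mem_of_closed (hclosed y) hz ⟨hy, rfl⟩,
      fun hz => (hconn y hy).symm.trans (hz.2 ▸ hconn z hz.1)⟩
  refine ⟨F, ⟨⟨?_, ?_⟩, fun y hy => ⟨c y, ?_, ?_⟩⟩, hcomp, hdist⟩
  · rintro _ ⟨w, rfl⟩
    exact (hlink w).edge_mem
  · rintro _ ⟨w, rfl⟩ hj
    rw [joined_iff_conn (hlink w)] at hj
    let R : α → α → Prop := fun a b => ∃ h, π ⟨a, h⟩ = b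
    let S : Set α := {a | Relation.ReflTransGen R a w}
    have hSD : ∀ a ∈ S, D w ≤ D a := by
      intro a ha
      induction ha using Relation.ReflTransGen.head_induction_on with
      | refl => exact le_rfl
      | head h _ ih =>
        obtain ⟨h', rfl⟩ := h
        exact ih.trans (hlt _).le
    have hiff : ∀ v : {y // y ∈ V ∧ c y ≠ y}, v ≠ w → (π v ∈ S ↔ (v : α) ∈ S) := by
      intro v hv
      refine ⟨fun h => h.head ⟨v.2, rfl⟩, fun h => ?_⟩
      obtain h | ⟨b, ⟨h', rfl⟩, hb⟩ := Relation.ReflTransGen.cases_head h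
      · exact absurd (Subtype.ext h) hv
      · exact hb
    have hScl : ∀ ⦃e a b⦄, (H.restrict (F \ {ε w})).IsLink e a b → a ∈ S → b ∈ S := by
      rintro _ a b ⟨⟨⟨v, rfl⟩, hv⟩, hab⟩ ha
      have hvw : v ≠ w := fun h => hv (by rw [h]; rfl)
      obtain ⟨rfl, rfl⟩ | ⟨rfl, rfl⟩ := hab.eq_and_eq_or_eq_and_eq (hlink v)
      exacts [(hiff v hvw).1 ha, (hiff v hvw).2 ha]
    exact (hlt w).not_ge (hSD _ (Conn.mem_of_closed hScl hj.symm .refl))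
  · rw [hcomp y hy]
    exact hcX y hy
  · rw [hcomp y hy]
    intro z hz
    have := hdist z hz.1
    rwa [hz.2, ← hD hz.2] at this

end Forest

/-! ### Discrete probability -/

section Probability

variable {σ : Type*}

theorem toOuterMeasure_le_one (p : PMF σ) (s : Set σ) : p.toOuterMeasure s ≤ 1 := by
  rw [PMF.toOuterMeasure_apply, ← p.tsum_coe]
  exact ENNReal.tsum_le_tsum fun a => Set.indicator_le_self _ _ a

theorem toOuterMeasure_add_compl (p : PMF σ) (s : Set σ) :
    p.toOuterMeasure s + p.toOuterMeasure sᶜ = 1 := by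
  rw [PMF.toOuterMeasure_apply, PMF.toOuterMeasure_apply, ← ENNReal.tsum_add, ← p.tsum_coe]
  exact tsum_congr fun a => Set.indicator_self_add_compl_apply s p a

end Probability

/-! ### Sequential ball carving -/

section Carving

open scoped NNReal

variable {α : Type*} {β : Type*} {H : Graph α β} {l : β → ℝ} {S : Set α} {v x y : α}

/-- The ball of radius `ρ` about `v` in the graph that `S` induces. It is empty if `v ∉ S`. -/
def ball (H : Graph α β) (l : β → ℝ) (S : Set α) (v : α) (ρ : ℝ≥0∞) : Set α :=
  {y ∈ S | gdist (H.induce S) l v y ≤ ρ}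

/-- The centre map which sends the vertices of `X` to `v`, and the others to their image
under `c`. -/
def recentre (v : α) (X : Set α) (c : α → α) (y : α) : α :=
  open Classical in if y ∈ X then v else c y

/-- Carve balls off the graph induced by `S`, one about each vertex of the list in turn (if that
vertex is still there), each in the graph left by the previous ones and with a fresh radius of law
`g`. The result is the map that sends each vertex to the centre of its ball. -/
def carve (H : Graph α β) (l : β → ℝ) (g : PMF ℝ≥0) : List α → Set α → PMF (α → α)
  | [], _ => PMF.pure id
  | v :: L, S => g.bind fun ρ =>
      (carve H l g L (S \ ball H l S v ρ)).map (recentre v (ball H l S v ρ))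

theorem centre_mem_ball {ρ : ℝ≥0∞} (h : x ∈ ball H l S v ρ) (hρ : ρ < ⊤) : v ∈ ball H l S v ρ := by
  refine ⟨?_, by simp⟩
  exact Conn.mem_of_closed (S := S) (fun _ _ _ h _ => h.right_mem)
    (conn_of_gdist_lt_top (h.2.trans_lt hρ)).symm h.1

/-- Shortest paths from the centre of a ball do not leave the ball. -/
theorem gdist_induce_ball [Finite α] [Finite β] (hl : ∀ e ∈ H.edgeSet, 0 < l e) {ρ : ℝ≥0∞}
    (hρ : ρ < ⊤) :
    ∀ y ∈ ball H l S v ρ, gdist (H.induce (ball H l S v ρ)) l v y ≤ gdist (H.induce S) l v y := by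
  have hwf : WellFounded (InvImage (· < ·) (gdist (H.induce S) l v)) :=
    Finite.wellFounded_of_trans_of_irrefl _
  intro y
  induction y using hwf.induction with
  | _ y ih =>
    intro hy
    obtain rfl | hne := eq_or_ne v y
    · simp
    · obtain ⟨e, z, he, h1, h2⟩ := exists_parent_lt
        (fun e he => by obtain ⟨_, _, h, -⟩ := he; exact hl e h.edge_mem) hne (hy.2.trans_lt hρ)
      have hz : z ∈ ball H l S v ρ := ⟨he.2.1, h2.le.trans hy.2⟩
      refine (gdist_triangle v z y).trans (le_trans ?_ h1)
      gcongr
      · exact ih z h2 hz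
      · exact gdist_le_of_isLink ⟨he.1, hz, hy⟩

theorem IsCentreMap.recentre [Finite α] [Finite β] (hl : ∀ e ∈ H.edgeSet, 0 < l e)
    {ρ B : ℝ≥0∞} {c : α → α} (hρ : ρ < ⊤) (hB : ρ ≤ B)
    (hc : IsCentreMap H l (S \ ball H l S v ρ) c B) :
    IsCentreMap H l S (recentre v (ball H l S v ρ) c) B := by
  set X := ball H l S v ρ with hX
  have hin : ∀ {y}, y ∈ X → TwoStage.recentre v X c y = v := fun h => if_pos h
  have hout : ∀ {y}, y ∉ X → TwoStage.recentre v X c y = c y := fun h => if_neg h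
  refine ⟨fun y hy => ?_, fun y hy => ?_, fun y hy => ?_⟩
  all_goals by_cases hyX : y ∈ X
  · rw [hin hyX]; exact (centre_mem_ball hyX hρ).1
  · rw [hout hyX]; exact (hc.mem y ⟨hy, hyX⟩).1
  · rw [hin hyX, hin (centre_mem_ball hyX hρ)]
  · rw [hout hyX, hout (hc.mem y ⟨hy, hyX⟩).2, hc.idem y ⟨hy, hyX⟩]
  · have hv := centre_mem_ball hyX hρ
    have hfib : {z ∈ S | TwoStage.recentre v X c z = TwoStage.recentre v X c y} = X := by
      ext z
      rw [hin hyX]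
      refine ⟨fun ⟨hz, h⟩ => ?_, fun hz => ⟨hz.1, hin hz⟩⟩
      by_contra hzX
      rw [hout hzX] at h
      exact (hc.mem z ⟨hz, hzX⟩).2 (h ▸ hv)
    rw [hfib, hin hyX]
    exact (gdist_induce_ball hl hρ y hyX).trans (hyX.2.trans hB)
  · have hfib : {z ∈ S | TwoStage.recentre v X c z = TwoStage.recentre v X c y} =
        {z ∈ S \ X | c z = c y} := by
      ext z
      rw [hout hyX]
      by_cases hzX : z ∈ X
      · have : v ≠ c y := fun h => (hc.mem y ⟨hy, hyX⟩).2 (h ▸ centre_mem_ball hzX hρ)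
        simp [hin hzX, hzX, this]
      · simp [hout hzX, hzX]
    rw [hfib, hout hyX]
    exact hc.dist y ⟨hy, hyX⟩

theorem diff_ball_subset {L : List α} {ρ : ℝ≥0∞} (hS : ∀ y ∈ S, y ∈ v :: L) :
    ∀ y ∈ S \ ball H l S v ρ, y ∈ L := by
  rintro y ⟨hy, hyX⟩
  obtain rfl | h := List.mem_cons.1 (hS y hy)
  · exact absurd ⟨hy, by simp⟩ hyX
  · exact h

theorem exists_isCentreMap_of_mem_support_carve [Finite α] [Finite β]
    (hl : ∀ e ∈ H.edgeSet, 0 < l e) {g : PMF ℝ≥0} {L : List α} (hS : ∀ y ∈ S, y ∈ L)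
    {c : α → α} (hc : c ∈ (carve H l g L S).support) :
    ∃ B < ⊤, IsCentreMap H l S c B := by
  induction L generalizing S c with
  | nil =>
    have : ∀ y ∉ ([] : List α), y ∉ S := fun y h h' => h (hS y h')
    refine ⟨0, by simp, ⟨?_, ?_, ?_⟩⟩ <;> exact fun y hy => absurd hy (this y (by simp))
  | cons v L ih =>
    simp only [carve, PMF.mem_support_bind_iff, PMF.mem_support_map_iff] at hc
    obtain ⟨ρ, -, c', hc', rfl⟩ := hc
    obtain ⟨B, hB, h⟩ := ih (diff_ball_subset hS) hc'
    refine ⟨max B ρ, max_lt hB (by simp), IsCentreMap.recentre hl (by simp) (le_max_right _ _) ?_⟩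
    exact ⟨h.mem, h.idem, fun y hy => (h.dist y hy).trans (le_max_left _ _)⟩

/-- A union bound over the radii of the balls. -/
theorem carve_radius_le [Finite α] [Finite β] (hl : ∀ e ∈ H.edgeSet, 0 < l e) {g : PMF ℝ≥0}
    (B : ℝ≥0∞) {L : List α} (hS : ∀ y ∈ S, y ∈ L) :
    (carve H l g L S).toOuterMeasure {c | ¬ IsCentreMap H l S c B} ≤
      L.length * g.toOuterMeasure {ρ | ¬ (ρ : ℝ≥0∞) ≤ B} := by
  induction L generalizing S with
  | nil =>
    have : ∀ c : α → α, IsCentreMap H l S c B := by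
      have : ∀ y ∉ ([] : List α), y ∉ S := fun y h h' => h (hS y h')
      intro c
      refine ⟨?_, ?_, ?_⟩ <;> exact fun y hy => absurd hy (this y (by simp))
    simp [this]
  | cons v L ih =>
    simp only [carve, PMF.toOuterMeasure_bind_apply, PMF.toOuterMeasure_map_apply]
    set τ := g.toOuterMeasure {ρ | ¬ (ρ : ℝ≥0∞) ≤ B} with hτ
    calc _ ≤ ∑' ρ, (({ρ : ℝ≥0 | ¬ (ρ : ℝ≥0∞) ≤ B}.indicator g ρ) + g ρ * (L.length * τ)) := by
          refine ENNReal.tsum_le_tsum fun ρ => ?_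
          by_cases hρ : (ρ : ℝ≥0∞) ≤ B
          · rw [Set.indicator_of_notMem (by simpa using hρ), zero_add]
            gcongr
            refine le_trans (MeasureTheory.measure_mono ?_) (ih (diff_ball_subset hS))
            exact fun c hc h => hc (IsCentreMap.recentre hl (by simp) hρ h)
          · rw [Set.indicator_of_mem (by simpa using hρ)]
            refine le_add_right (mul_le_of_le_one_right' ?_)
            exact toOuterMeasure_le_one _ _
      _ = _ := by
          rw [ENNReal.tsum_add, ENNReal.tsum_mul_right, PMF.tsum_coe, one_mul,
            ← PMF.toOuterMeasure_apply, List.length_cons]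
          push_cast
          ring

/-- If the law of the radii is memoryless up to a factor `b` at the scale of the edge `e`, then `e`
is cut with probability at most `b`. Whichever ball first reaches an end of `e` contains both ends
unless its radius stops within `l e`, and conditionally on having reached `e` this has
probability at most `b`. -/
theorem carve_cut_le {g : PMF ℝ≥0} {e : β} {b : ℝ≥0∞} (hxy : H.IsLink e x y)
    (hb : ∀ D : ℝ≥0∞, g.toOuterMeasure {ρ | D ≤ ρ ∧ (ρ : ℝ≥0∞) < D + ENNReal.ofReal (l e)} ≤
      b * g.toOuterMeasure {ρ | D ≤ ρ})
    {L : List α} (hS : ∀ y ∈ S, y ∈ L) (hx : x ∈ S) (hy : y ∈ S) :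
    (carve H l g L S).toOuterMeasure {c | c x ≠ c y} ≤ b := by
  induction L generalizing S with
  | nil => exact absurd (hS x hx) (by simp)
  | cons v L ih =>
    set dist := gdist (H.induce S) l v with hdist
    set D := min (dist x) (dist y) with hD
    have hlink : (H.induce S).IsLink e x y := ⟨hxy, hx, hy⟩
    have hDx : dist x ≤ D + ENNReal.ofReal (l e) := by
      rw [hD, ← min_add_add_right]
      refine le_min le_self_add ?_
      exact (gdist_triangle v y x).trans (by gcongr; exact gdist_le_of_isLink hlink.symm)
    have hDy : dist y ≤ D + ENNReal.ofReal (l e) := by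
      rw [hD, ← min_add_add_right]
      refine le_min ?_ le_self_add
      exact (gdist_triangle v x y).trans (by gcongr; exact gdist_le_of_isLink hlink)
    set T : Set ℝ≥0 := {ρ | D ≤ ρ ∧ (ρ : ℝ≥0∞) < D + ENNReal.ofReal (l e)} with hT
    set U : Set ℝ≥0 := {ρ | D ≤ ρ} with hU
    simp only [carve, PMF.toOuterMeasure_bind_apply, PMF.toOuterMeasure_map_apply]
    calc _ ≤ ∑' ρ, (T.indicator g ρ + b * Uᶜ.indicator g ρ) := by
          refine ENNReal.tsum_le_tsum fun ρ => ?_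
          by_cases hρU : ρ ∈ U
          · by_cases hρ : ρ ∈ T
            · rw [Set.indicator_of_mem hρ]
              exact le_add_right (mul_le_of_le_one_right' (toOuterMeasure_le_one _ _))
            · have hle : D + ENNReal.ofReal (l e) ≤ ρ := not_lt.1 fun h => hρ ⟨hρU, h⟩
              have hxX : x ∈ ball H l S v ρ := ⟨hx, hDx.trans hle⟩
              have hyX : y ∈ ball H l S v ρ := ⟨hy, hDy.trans hle⟩
              have : recentre v (ball H l S v ρ) ⁻¹' {c | c x ≠ c y} = ∅ := by
                ext c
                simp [recentre, hxX, hyX]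
              simp [this]
          · rw [Set.indicator_of_mem (show ρ ∈ Uᶜ from hρU), mul_comm b]
            refine le_add_left (mul_le_mul_right ?_ _)
            have hlt : (ρ : ℝ≥0∞) < D := not_le.1 hρU
            have hxX : x ∉ ball H l S v ρ := fun h => (hlt.trans_le (min_le_left _ _)).not_ge h.2
            have hyX : y ∉ ball H l S v ρ := fun h => (hlt.trans_le (min_le_right _ _)).not_ge h.2
            have hpre : recentre v (ball H l S v ρ) ⁻¹' {c | c x ≠ c y} = {c | c x ≠ c y} := by
              ext c
              simp [recentre, hxX, hyX]
            rw [hpre]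
            exact ih (diff_ball_subset hS) ⟨hx, hxX⟩ ⟨hy, hyX⟩
      _ = g.toOuterMeasure T + b * g.toOuterMeasure Uᶜ := by
          rw [ENNReal.tsum_add, ENNReal.tsum_mul_left, PMF.toOuterMeasure_apply,
            PMF.toOuterMeasure_apply]
      _ ≤ b * (g.toOuterMeasure U + g.toOuterMeasure Uᶜ) := by
          rw [mul_add]
          gcongr
          exact hb D
      _ = b := by
          rw [toOuterMeasure_add_compl, mul_one]

/-! ### Geometric radii and the existence of Partition -/

/-- The geometric law on `ℕ` with masses `(1 - θ) θ ^ m`. -/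
def geomLaw (θ : ℝ≥0∞) (hθ : θ < 1) : PMF ℕ :=
  ⟨fun m => (1 - θ) * θ ^ m, by
    have h : ∑' m : ℕ, (1 - θ) * θ ^ m = 1 := by
      rw [ENNReal.tsum_mul_left, ENNReal.tsum_geometric]
      exact ENNReal.mul_inv_cancel (tsub_pos_of_lt hθ).ne' (by simp)
    exact (Summable.hasSum_iff ENNReal.summable).2 h⟩

theorem geomLaw_apply {θ : ℝ≥0∞} (hθ : θ < 1) (m : ℕ) : geomLaw θ hθ m = (1 - θ) * θ ^ m := rfl

theorem geomLaw_tail {θ : ℝ≥0∞} (hθ : θ < 1) (a : ℕ) :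
    (geomLaw θ hθ).toOuterMeasure (Set.Ici a) = θ ^ a := by
  have hinj : Function.Injective fun j : ℕ => j + a := add_left_injective a
  rw [PMF.toOuterMeasure_apply, ← hinj.tsum_eq]
  · have : ∀ j : ℕ, (Set.Ici a).indicator (geomLaw θ hθ) (j + a) = θ ^ a * geomLaw θ hθ j := by
      intro j
      rw [Set.indicator_of_mem (by simp), geomLaw_apply, geomLaw_apply, pow_add]
      ring
    simp_rw [this, ENNReal.tsum_mul_left, PMF.tsum_coe, mul_one]
  · intro m hm
    have : a ≤ m := by
      by_contra h
      exact hm (Set.indicator_of_notMem (by simpa using h) _)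
    exact ⟨m - a, by simp [this]⟩

theorem geomLaw_Ico_le {θ : ℝ≥0∞} (hθ : θ < 1) (a N : ℕ) :
    (geomLaw θ hθ).toOuterMeasure (Set.Ico a (a + N)) ≤
      N * (1 - θ) * (geomLaw θ hθ).toOuterMeasure (Set.Ici a) := by
  rw [geomLaw_tail, ← Finset.coe_Ico, PMF.toOuterMeasure_apply_finset]
  calc _ ≤ ∑ _m ∈ Finset.Ico a (a + N), (1 - θ) * θ ^ a := by
        refine Finset.sum_le_sum fun m hm => ?_
        rw [geomLaw_apply]
        gcongr _ * ?_
        exact pow_le_pow_right_of_le_one' hθ.le (Finset.mem_Ico.1 hm).1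
    _ = _ := by simp [mul_assoc]

/-- The law of a radius which is a multiple of `η`, the factor being geometric. -/
def radiusLaw (θ : ℝ≥0∞) (hθ : θ < 1) (η : ℝ≥0) : PMF ℝ≥0 :=
  (geomLaw θ hθ).map fun m : ℕ => η * (m : ℝ≥0)

/-- Conditionally on having reached `D`, the radius stops within `ℓ` only if one of the next `N`
trials of the geometric law succeeds, and each of them does with probability `1 - θ`. -/
theorem radiusLaw_memoryless {θ : ℝ≥0∞} (hθ : θ < 1) {η : ℝ≥0} {ℓ : ℝ≥0∞} {N : ℕ}
    (hN : ℓ ≤ η * N) (D : ℝ≥0∞) :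
    (radiusLaw θ hθ η).toOuterMeasure {ρ | D ≤ ρ ∧ (ρ : ℝ≥0∞) < D + ℓ} ≤
      N * (1 - θ) * (radiusLaw θ hθ η).toOuterMeasure {ρ | D ≤ ρ} := by
  classical
  simp only [radiusLaw, PMF.toOuterMeasure_map_apply, Set.preimage_ofPred_eq, ENNReal.coe_mul,
    ENNReal.coe_natCast]
  by_cases hex : ∃ m : ℕ, D ≤ η * m
  · refine le_trans (MeasureTheory.measure_mono ?_)
      ((geomLaw_Ico_le hθ (Nat.find hex) N).trans
        (mul_le_mul_right (MeasureTheory.measure_mono ?_) _))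
    · rintro m ⟨h1, h2⟩
      refine ⟨Nat.find_min' hex h1, not_le.1 fun hm => h2.not_ge ?_⟩
      calc D + ℓ ≤ η * (Nat.find hex : ℕ) + η * N := add_le_add (Nat.find_spec hex) hN
        _ = η * ((Nat.find hex + N : ℕ) : ℝ≥0∞) := by push_cast; ring
        _ ≤ η * m := by gcongr
    · intro m hm
      exact (Nat.find_spec hex).trans (by gcongr; exact hm)
  · have : {m : ℕ | D ≤ (η : ℝ≥0∞) * m ∧ (η : ℝ≥0∞) * m < D + ℓ} = ∅ :=
      Set.eq_empty_of_forall_notMem fun m hm => hex ⟨m, hm.1⟩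
    simp [this]

theorem radiusLaw_tail_le {θ : ℝ≥0∞} (hθ : θ < 1) {η : ℝ≥0} {B : ℝ≥0∞} {a : ℕ}
    (ha : ∀ m : ℕ, B < η * m → a ≤ m) :
    (radiusLaw θ hθ η).toOuterMeasure {ρ | ¬ (ρ : ℝ≥0∞) ≤ B} ≤ θ ^ a := by
  rw [← geomLaw_tail hθ a, radiusLaw, PMF.toOuterMeasure_map_apply]
  refine MeasureTheory.measure_mono fun m hm => ha m ?_
  simpa using hm

theorem logn_nonneg (H : Graph α β) : 0 ≤ logn H := by
  rw [logn]
  obtain h | h := Nat.eq_zero_or_pos H.vertexSet.ncard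
  · simp [h]
  · exact Real.logb_nonneg one_lt_two (by exact_mod_cast h)

theorem two_le_ncard [Finite α] (hH : H.Loopless) {e : β} (he : e ∈ H.edgeSet) :
    2 ≤ H.vertexSet.ncard :=
  (Set.one_lt_ncard (Set.toFinite _)).2 <| by
    obtain ⟨x, y, h⟩ := Graph.exists_isLink_of_mem_edgeSet he
    exact ⟨x, h.left_mem, y, h.right_mem, h.ne⟩

theorem one_le_logn [Finite α] (hH : H.Loopless) {e : β} (he : e ∈ H.edgeSet) : 1 ≤ logn H := by
  rw [logn, Real.le_logb_iff_rpow_le one_lt_two (by have := two_le_ncard hH he; positivity)]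
  exact_mod_cast two_le_ncard hH he

/-- The forests of a random centre map have the same cut and diameter probabilities as the map. -/
theorem exists_law_of_carve [Finite α] [Finite β] (hl : ∀ e ∈ H.edgeSet, 0 < l e) (g : PMF ℝ≥0)
    {d : ℝ} (hd : 0 < d) {b : β → ℝ≥0∞}
    (hb : ∀ e ∈ H.edgeSet, ∀ D : ℝ≥0∞,
      g.toOuterMeasure {ρ | D ≤ ρ ∧ (ρ : ℝ≥0∞) < D + ENNReal.ofReal (l e)} ≤
        b e * g.toOuterMeasure {ρ | D ≤ ρ}) :
    ∃ μ : PMF (Set β), (∀ F ∈ μ.support, IsShortestPathForest H l F) ∧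
      μ.toOuterMeasure {F | ¬ DiamLE H l F d} ≤
        H.vertexSet.ncard * g.toOuterMeasure {ρ | ¬ (ρ : ℝ≥0∞) ≤ ENNReal.ofReal (d / 2)} ∧
      ∀ e ∈ H.edgeSet, μ.toOuterMeasure {F | ¬ Joined H F e} ≤ b e := by
  -- maps which `carve` never returns need not be centre maps, and get an arbitrary edge set
  have hex : ∀ c : α → α, ∃ F, ∀ B < ⊤, IsCentreMap H l H.vertexSet c B →
      IsShortestPathForest H l F ∧
      (∀ y ∈ H.vertexSet, comp (H.restrict F) y = {z ∈ H.vertexSet | c z = c y}) ∧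
      ∀ y ∈ H.vertexSet, gdist (H.restrict F) l (c y) y =
        gdist (H.induce {z ∈ H.vertexSet | c z = c y}) l (c y) y := by
    intro c
    by_cases h : ∃ B < ⊤, IsCentreMap H l H.vertexSet c B
    · obtain ⟨B, hB, hc⟩ := h
      obtain ⟨F, hF⟩ := hc.exists_forest hl hB
      exact ⟨F, fun _ _ _ => hF⟩
    · exact ⟨∅, fun B hB hc => absurd ⟨B, hB, hc⟩ h⟩
  choose Φ hΦ using hex
  set L := (Set.toFinite H.vertexSet).toFinset.toList with hL
  have hVL : ∀ y ∈ H.vertexSet, y ∈ L := fun y hy => by simpa [hL] using hy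
  have hlen : L.length = H.vertexSet.ncard := by
    rw [hL, Finset.length_toList, Set.ncard_eq_toFinset_card _ (Set.toFinite _)]
  refine ⟨(carve H l g L H.vertexSet).map Φ, ?_, ?_, fun e he => ?_⟩
  · intro F hF
    obtain ⟨c, hc, rfl⟩ := (PMF.mem_support_map_iff _ _ _).1 hF
    obtain ⟨B, hB, h⟩ := exists_isCentreMap_of_mem_support_carve hl hVL hc
    exact (hΦ c B hB h).1
  · rw [PMF.toOuterMeasure_map_apply, ← hlen]
    refine le_trans (MeasureTheory.measure_mono ?_)
      (carve_radius_le hl (ENNReal.ofReal (d / 2)) hVL)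
    refine fun c hc h => hc ?_
    obtain ⟨-, hcomp, hdist⟩ := hΦ c _ ENNReal.ofReal_lt_top h
    intro x hx y hy
    rw [hcomp x hx] at hy
    have hbound : ∀ z ∈ H.vertexSet,
        gdist (H.restrict (Φ c)) l (c z) z ≤ ENNReal.ofReal (d / 2) := fun z hz =>
      (hdist z hz).trans_le (h.dist z hz)
    calc _ ≤ gdist (H.restrict (Φ c)) l x (c x) + gdist (H.restrict (Φ c)) l (c x) y :=
          gdist_triangle _ _ _
      _ ≤ ENNReal.ofReal (d / 2) + ENNReal.ofReal (d / 2) := by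
          gcongr
          · rw [gdist_comm]; exact hbound x hx
          · rw [← hy.2]; exact hbound y hy.1
      _ = ENNReal.ofReal d := by
          rw [← ENNReal.ofReal_add (by positivity) (by positivity), add_halves]
  · obtain ⟨x, y, hxy⟩ := Graph.exists_isLink_of_mem_edgeSet he
    rw [PMF.toOuterMeasure_map_apply]
    refine le_trans (PMF.toOuterMeasure_mono _ ?_)
      (carve_cut_le hxy (hb e he) hVL hxy.left_mem hxy.right_mem)
    rintro c ⟨hc, hsupp⟩ heq
    obtain ⟨B, hB, h⟩ := exists_isCentreMap_of_mem_support_carve hl hVL hsupp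
    refine hc ((joined_iff_conn hxy).2 ?_)
    change y ∈ comp _ x
    rw [(hΦ c B hB h).2.1 x hxy.left_mem]
    exact ⟨hxy.right_mem, heq.symm⟩

/-- With radii of expectation of order `d / (k log n)`, no radius exceeds `d / 2`, except with
probability `n ^ (-k)`. The unit of length `η` is at most every edge length, so that rounding
lengths up to multiples of `η` at most doubles them. -/
theorem exists_partition_law [Finite α] [Finite β] (k : ℕ) (hH : H.Loopless)
    (hl : ∀ e ∈ H.edgeSet, 0 < l e) {d : ℝ} (hd : 0 < d) :
    ∃ μ : PMF (Set β), (∀ F ∈ μ.support, IsShortestPathForest H l F) ∧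
      μ.toOuterMeasure {F | ¬ DiamLE H l F d} ≤
        ENNReal.ofReal (1 / (H.vertexSet.ncard : ℝ) ^ k) ∧
      ∀ e ∈ H.edgeSet, μ.toOuterMeasure {F | ¬ Joined H F e} ≤
        ENNReal.ofReal (8 * (k + 1) * l e * logn H / d) := by
  obtain ⟨η₀, hη₀, hmin⟩ : ∃ η₀ : ℝ, 0 < η₀ ∧ ∀ e ∈ H.edgeSet, η₀ ≤ l e := by
    obtain h | h := H.edgeSet.eq_empty_or_nonempty
    · exact ⟨1, one_pos, by simp [h]⟩
    · obtain ⟨e, he, hmin⟩ := Set.exists_min_image _ l (Set.toFinite _) h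
      exact ⟨l e, hl e he, hmin⟩
  have hlog := logn_nonneg H
  -- the rate of the radii; adding one to the logarithm keeps it positive for a single vertex and
  -- costs at most a factor two as soon as there is an edge
  set lam : ℝ := 2 * (k + 1) * (logn H + 1) / d with hlam
  have hlam0 : 0 < lam := by positivity
  set η : ℝ := min η₀ (1 / (2 * lam)) with hη
  have hη0 : 0 < η := lt_min hη₀ (by positivity)
  set p : ℝ := lam * η with hp
  have hp0 : 0 < p := by positivity
  have hp1 : p ≤ 1 / 2 := by
    calc p ≤ lam * (1 / (2 * lam)) := by rw [hp]; gcongr; exact min_le_right _ _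
      _ = 1 / 2 := by field_simp
  have hθ : ENNReal.ofReal (1 - p) < 1 := by
    rw [← ENNReal.ofReal_one]
    exact (ENNReal.ofReal_lt_ofReal_iff one_pos).2 (by linarith)
  have hθ' : 1 - ENNReal.ofReal (1 - p) = ENNReal.ofReal p := by
    rw [← ENNReal.ofReal_one, ← ENNReal.ofReal_sub _ (by linarith)]
    congr 1; ring
  have hcoe : ((η.toNNReal : ℝ≥0) : ℝ≥0∞) = ENNReal.ofReal η := rfl
  obtain ⟨μ, h1, h2, h3⟩ := exists_law_of_carve (H := H) hl (radiusLaw _ hθ η.toNNReal) hd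
    (b := fun e => (⌈l e / η⌉₊ : ℝ≥0∞) * (1 - ENNReal.ofReal (1 - p))) fun e he D => by
      refine radiusLaw_memoryless hθ ?_ D
      rw [hcoe, ← ENNReal.ofReal_natCast, ← ENNReal.ofReal_mul hη0.le]
      refine ENNReal.ofReal_le_ofReal ?_
      rw [← div_le_iff₀' hη0]
      exact Nat.le_ceil _
  refine ⟨μ, h1, h2.trans ?_, fun e he => (h3 e he).trans ?_⟩
  · obtain hn | hn := Nat.eq_zero_or_pos H.vertexSet.ncard
    · simp [hn]
    have hn' : (0 : ℝ) < H.vertexSet.ncard := by exact_mod_cast hn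
    have htail := radiusLaw_tail_le hθ (η := η.toNNReal) (B := ENNReal.ofReal (d / 2))
      (a := ⌈d / (2 * η)⌉₊) fun m hm => by
        rw [hcoe, ← ENNReal.ofReal_natCast, ← ENNReal.ofReal_mul hη0.le,
          ENNReal.ofReal_lt_ofReal_iff_of_nonneg (by positivity)] at hm
        refine Nat.ceil_le.2 ?_
        rw [div_le_iff₀ (by positivity)]
        linarith
    refine (mul_le_mul_right htail _).trans ?_
    rw [← ENNReal.ofReal_pow (by linarith), ← ENNReal.ofReal_natCast,
      ← ENNReal.ofReal_mul (by positivity)]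
    refine ENNReal.ofReal_le_ofReal ?_
    have hlnlog : Real.log H.vertexSet.ncard ≤ logn H := by
      rw [logn, Real.logb, le_div_iff₀ (Real.log_pos one_lt_two)]
      refine mul_le_of_le_one_right (Real.log_natCast_nonneg _) ?_
      linarith [Real.log_two_lt_d9]
    have hexp : (1 - p) ^ ⌈d / (2 * η)⌉₊ ≤ 1 / (H.vertexSet.ncard : ℝ) ^ (k + 1) := by
      calc (1 - p) ^ ⌈d / (2 * η)⌉₊ ≤ Real.exp (-p) ^ ⌈d / (2 * η)⌉₊ := by
            gcongr
            · linarith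
            · exact Real.one_sub_le_exp_neg p
        _ = Real.exp (-(p * ⌈d / (2 * η)⌉₊)) := by rw [← Real.exp_nat_mul]; ring_nf
        _ ≤ Real.exp (-(p * (d / (2 * η)))) := by gcongr; exact Nat.le_ceil _
        _ = Real.exp (-((k + 1) * (logn H + 1))) := by
            congr 2
            rw [hp, hlam]
            field_simp
        _ ≤ Real.exp (-((k + 1 : ℕ) * Real.log H.vertexSet.ncard)) := by
            push_cast
            gcongr
            linarith
        _ = _ := by rw [Real.exp_neg, Real.exp_nat_mul, Real.exp_log hn', one_div]
    calc _ ≤ (H.vertexSet.ncard : ℝ) * (1 / (H.vertexSet.ncard : ℝ) ^ (k + 1)) := by gcongr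
      _ = _ := by rw [pow_succ]; field_simp
  · -- rounding up to a multiple of `η ≤ l e` at most doubles the length
    have hlog1 := one_le_logn hH he
    have hle : 1 ≤ l e / η := (one_le_div hη0).2 ((min_le_left _ _).trans (hmin e he))
    rw [hθ', ← ENNReal.ofReal_natCast, ← ENNReal.ofReal_mul (by positivity)]
    refine ENNReal.ofReal_le_ofReal ?_
    have hl0 := hl e he
    calc (⌈l e / η⌉₊ : ℝ) * p ≤ (2 * (l e / η)) * p := by
          gcongr
          linarith [Nat.ceil_lt_add_one (zero_le_one.trans hle)]
      _ = 4 * (k + 1) * l e * (logn H + 1) / d := by rw [hp, hlam]; field_simp; ring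
      _ ≤ 4 * (k + 1) * l e * (logn H + logn H) / d := by gcongr
      _ = _ := by ring

theorem exists_isPartitionRoutine (k : ℕ) (α : Type u) (β : Type v) [Finite α] [Finite β] :
    ∃ P : PartitionRoutine α β, IsPartitionRoutine (8 * (k + 1)) k P := by
  have h : ∀ (H : Graph α β) (l : β → ℝ) (d : ℝ), ∃ μ : PMF (Set β), H.Loopless →
      (∀ e ∈ H.edgeSet, 0 < l e) → 0 < d →
      (∀ F ∈ μ.support, IsShortestPathForest H l F) ∧
      μ.toOuterMeasure {F | ¬ DiamLE H l F d} ≤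
        ENNReal.ofReal (1 / (H.vertexSet.ncard : ℝ) ^ k) ∧
      ∀ e ∈ H.edgeSet, μ.toOuterMeasure {F | ¬ Joined H F e} ≤
        ENNReal.ofReal (8 * (k + 1) * l e * logn H / d) := by
    intro H l d
    by_cases hv : H.Loopless ∧ (∀ e ∈ H.edgeSet, 0 < l e) ∧ 0 < d
    · obtain ⟨μ, hμ⟩ := exists_partition_law k hv.1 hv.2.1 hv.2.2
      exact ⟨μ, fun _ _ _ => hμ⟩
    · exact ⟨PMF.pure ∅, fun h1 h2 h3 => absurd ⟨h1, h2, h3⟩ hv⟩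
  choose P hP using h
  exact ⟨P, fun H l d h1 h2 h3 => (hP H l d h1 h2 h3).1,
    fun H l d h1 h2 h3 => (hP H l d h1 h2 h3).2.1, fun H l d h1 h2 h3 => (hP H l d h1 h2 h3).2.2⟩

end Carving

/-! ### The output law of a loop -/

section Loop

open Filter Topology

variable {σ : Type*} {halt : σ → Prop} {step : σ → PMF σ} {x₀ : σ}

theorem loopRun_succ_toOuterMeasure (N : ℕ) (S : Set σ) :
    (loopRun halt step x₀ (N + 1)).toOuterMeasure S =
      ∑' x, loopRun halt step x₀ N x *
        (open Classical in if halt x then PMF.pure x else step x).toOuterMeasure S := by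
  rw [loopRun, PMF.toOuterMeasure_bind_apply]

/-- The mass of a final state only grows, so that the supremum in `loopLaw` is a limit. -/
theorem loopRun_monotone {y : σ} (hy : halt y) : Monotone fun N => loopRun halt step x₀ N y := by
  refine monotone_nat_of_le_succ fun N => ?_
  rw [loopRun, PMF.bind_apply]
  refine le_trans ?_ (ENNReal.le_tsum y)
  simp [hy]

theorem halt_of_loopLaw_ne_zero {y : σ} (h : loopLaw halt step x₀ y ≠ 0) : halt y := by
  by_contra hy
  exact h (by simp [loopLaw, hy])

theorem prob_loopLaw_le {S : Set σ} {B : ℝ≥0∞} {N₀ : ℕ}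
    (hB : ∀ N ≥ N₀, (loopRun halt step x₀ N).toOuterMeasure S ≤ B) :
    prob (loopLaw halt step x₀) S ≤ B := by
  classical
  have hmono : ∀ x, Monotone fun N : ℕ =>
      S.indicator (fun y => if halt y then loopRun halt step x₀ N y else 0) x := by
    intro x M N hMN
    by_cases hx : x ∈ S <;> by_cases hh : halt x
    · simpa [hx, hh] using loopRun_monotone hh hMN
    all_goals simp [hx, hh]
  have hsup : ∀ x, S.indicator (loopLaw halt step x₀) x =
      ⨆ N, S.indicator (fun y => if halt y then loopRun halt step x₀ N y else 0) x := by
    intro x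
    by_cases hx : x ∈ S
    · simp only [Set.indicator_of_mem hx, loopLaw]
    · simp [hx]
  rw [prob, ENNReal.tsum_eq_iSup_sum]
  refine iSup_le fun s => ?_
  simp_rw [hsup]
  rw [ENNReal.finsetSum_iSup_of_monotone hmono]
  refine iSup_le fun N => ?_
  refine le_trans ?_ (hB (max N N₀) (le_max_right _ _))
  rw [PMF.toOuterMeasure_apply]
  refine le_trans (Finset.sum_le_sum fun x _ => hmono x (le_max_left N N₀)) ?_
  refine le_trans (ENNReal.sum_le_tsum s) (ENNReal.tsum_le_tsum fun x => ?_)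
  refine Set.indicator_le_indicator ?_
  split_ifs <;> simp

theorem tsum_loopLaw_eq_one
    (h : Tendsto (fun N => (loopRun halt step x₀ N).toOuterMeasure {x | ¬ halt x}) atTop (𝓝 0)) :
    ∑' x, loopLaw halt step x₀ x = 1 := by
  refine le_antisymm ?_ ?_
  · have := prob_loopLaw_le (halt := halt) (step := step) (x₀ := x₀) (S := Set.univ) (N₀ := 0)
      fun N _ => toOuterMeasure_le_one _ _
    simpa [prob] using this
  · have hle : ∀ N, 1 ≤ (loopRun halt step x₀ N).toOuterMeasure {x | ¬ halt x} +
        ∑' x, loopLaw halt step x₀ x := by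
      intro N
      rw [← toOuterMeasure_add_compl (loopRun halt step x₀ N) {x | ¬ halt x}]
      gcongr
      rw [PMF.toOuterMeasure_apply]
      refine ENNReal.tsum_le_tsum fun x => ?_
      by_cases hx : halt x
      · rw [Set.indicator_of_mem (by simpa using hx)]
        refine le_trans ?_ (le_iSup _ N)
        simp [hx]
      · rw [Set.indicator_of_notMem (by simpa using hx)]
        exact zero_le
    have := ge_of_tendsto' (h.add_const (∑' x, loopLaw halt step x₀ x)) hle
    simpa using this

end Loop

/-! ### Quotient graphs -/

section Contract

variable {V : Type*} {E : Type*} {G : Graph V E} {A F : Set E} {e : E}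

/-- A path in the quotient `G / A` lifts to a path in `G` that also uses edges of `A`. -/
theorem conn_of_conn_contract {X Y : Set V} (h : Conn ((contract G A).restrict F) X Y) :
    ∀ x y, comp (G.restrict A) x = X → comp (G.restrict A) y = Y →
      Conn (G.restrict (A ∪ F)) x y := by
  induction h with
  | refl =>
    rintro x y rfl hy
    exact (comp_eq_iff_conn.1 hy.symm).restrict_mono Set.subset_union_left
  | tail _ h ih =>
    rintro x y hx hy
    obtain ⟨e, heF, u, v, huv, hu, rfl⟩ := h
    exact ((ih x u hx hu).tail ⟨e, Or.inr heF, huv⟩).trans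
      ((comp_eq_iff_conn.1 hy).symm.restrict_mono Set.subset_union_left)

theorem joined_union_of_joined_contract {H : Graph (Set V) E} (hH : H ≤ contract G A)
    (h : Joined H F e) : Joined G (A ∪ F) e := by
  obtain ⟨X, Y, he, hc⟩ := h
  obtain ⟨x, y, hxy, rfl, rfl⟩ := hH.isLink_mono he
  exact ⟨x, y, hxy, conn_of_conn_contract (Conn.mono (G := H.restrict F)
    (H := (contract G A).restrict F) (fun _ _ _ h => ⟨h.1, hH.isLink_mono h.2⟩) hc) x y rfl rfl⟩

theorem loopless_of_le_contract {H : Graph (Set V) E} (hH : H ≤ contract G A)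
    (h : ∀ e ∈ H.edgeSet, ¬ Joined G A e) : H.Loopless := by
  refine ⟨fun e X hX => h e (Graph.IsLoopAt.edge_mem hX) ?_⟩
  obtain ⟨x, y, hxy, hx, hy⟩ := hH.isLink_mono hX
  exact ⟨x, y, hxy, comp_eq_iff_conn.1 (hx.trans hy.symm)⟩

theorem logn_mono_of_ncard_le {α' : Type*} {β' : Type*} {H : Graph α' β'}
    (h : H.vertexSet.ncard ≤ G.vertexSet.ncard) : logn H ≤ logn G := by
  obtain h0 | h0 := Nat.eq_zero_or_pos H.vertexSet.ncard
  · have : logn H = 0 := by simp [logn, h0]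
    exact this ▸ logn_nonneg G
  · exact Real.logb_le_logb_of_le one_lt_two (by exact_mod_cast h0) (by exact_mod_cast h)

theorem logn_le_of_le_contract [Finite V] {H : Graph (Set V) E} (hH : H ≤ contract G A) :
    logn H ≤ logn G :=
  logn_mono_of_ncard_le <| (Set.ncard_le_ncard hH.vertexSet_mono (Set.toFinite _)).trans
    (Set.ncard_image_le (Set.toFinite _))

end Contract

/-! ### AKPW -/

section AKPW

open Filter Topology

variable {V : Type*} {E : Type*} {G : Graph V E} {l : E → ℝ} {C δ : ℝ}
  {k : ℕ} {P : PartitionRoutine (Set V) E} {e : E}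

theorem akpwGraph_le (s : ℕ) (A : Set E) : akpwGraph G l δ s A ≤ contract G A :=
  Graph.restrict_le

/-- One round leaves an edge of the buckets considered so far uncontracted with probability at most
`3 C log n / δ`. -/
theorem akpw_round_cut_le [Finite V] (hP : IsPartitionRoutine C k P) (hC : 0 < C)
    (hδ : 0 < δ) {b s : ℕ}
    (hb : e ∈ bucket G l δ b) (hbs : b ≤ s) {A : Set E} (hA : ¬ Joined G A e) :
    (P (akpwGraph G l δ s A) (fun _ => 1) (δ / 3)).toOuterMeasure {T | ¬ Joined G (A ∪ T) e} ≤
      ENNReal.ofReal (3 * C * logn G / δ) := by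
  have hle := akpwGraph_le (G := G) (l := l) (δ := δ) s A
  have hmem : e ∈ (akpwGraph G l δ s A).edgeSet := ⟨hb.1, ⟨b, hbs, hb⟩, hA⟩
  have hloop : (akpwGraph G l δ s A).Loopless :=
    loopless_of_le_contract hle fun e he => he.2.2
  calc _ ≤ (P (akpwGraph G l δ s A) (fun _ => 1) (δ / 3)).toOuterMeasure
          {F | ¬ Joined (akpwGraph G l δ s A) F e} := by
        refine MeasureTheory.measure_mono ?_
        exact fun T hT h => hT (joined_union_of_joined_contract hle h)
    _ ≤ ENNReal.ofReal (C * 1 * logn (akpwGraph G l δ s A) / (δ / 3)) :=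
        hP.cut _ _ _ hloop (fun _ _ => one_pos) (by positivity) e hmem
    _ ≤ _ := by
        refine ENNReal.ofReal_le_ofReal ?_
        calc C * 1 * logn (akpwGraph G l δ s A) / (δ / 3) ≤ C * 1 * logn G / (δ / 3) := by
              gcongr
              exact logn_le_of_le_contract hle
          _ = _ := by field_simp

/-- The law of the run after `N` rounds. -/
abbrev akpwRun (P : PartitionRoutine (Set V) E) (G : Graph V E) (l : E → ℝ) (δ : ℝ) (N : ℕ) :
    PMF (List (Set E)) :=
  loopRun (akpwDone G) (akpwStep P G l δ) [∅] N

theorem joined_of_akpwDone {𝒜 : List (Set E)} (h : akpwDone G 𝒜) (he : e ∈ G.edgeSet) :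
    Joined G (𝒜.getLastD ∅) e := by
  obtain ⟨x, y, hxy⟩ := Graph.exists_isLink_of_mem_edgeSet he
  exact ⟨x, y, hxy, h x hxy.left_mem y hxy.right_mem⟩

/-- Every round that is run appends one set. -/
theorem akpwRun_length {N : ℕ} {𝒜 : List (Set E)} (h : 𝒜 ∈ (akpwRun P G l δ N).support) :
    𝒜.length = N + 1 ∨ (akpwDone G 𝒜 ∧ 𝒜 ≠ [] ∧ 𝒜.length ≤ N + 1) := by
  induction N generalizing 𝒜 with
  | zero =>
    have : 𝒜 = [∅] := by simpa [loopRun] using h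
    simp [this]
  | succ N ih =>
    simp only [akpwRun, loopRun, PMF.mem_support_bind_iff] at h
    obtain ⟨ℬ, hℬ, h⟩ := h
    split_ifs at h with hd
    · have : 𝒜 = ℬ := by simpa using h
      subst this
      obtain h | h := ih hℬ
      · exact Or.inr ⟨hd, by rintro rfl; simp at h, by omega⟩
      · exact Or.inr ⟨hd, h.2.1, by omega⟩
    · obtain h' | h' := ih hℬ
      · obtain ⟨T, -, rfl⟩ := (PMF.mem_support_map_iff _ _ _).1 h
        simp [h']
      · exact absurd h'.1 hd

/-- The rounds from `b` on are independent attempts at joining the ends of an edge of the bucket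
`b`. -/
theorem akpwRun_last_le [Finite V] (hP : IsPartitionRoutine C k P) (hC : 0 < C) (hδ : 0 < δ) {b : ℕ}
    (hb : e ∈ bucket G l δ b) (N : ℕ) :
    (akpwRun P G l δ N).toOuterMeasure {𝒜 | ¬ Joined G (𝒜.getLastD ∅) e} ≤
      ENNReal.ofReal (3 * C * logn G / δ) ^ (N - b) := by
  set r := ENNReal.ofReal (3 * C * logn G / δ) with hr
  set S : Set (List (Set E)) := {𝒜 | ¬ Joined G (𝒜.getLastD ∅) e} with hS
  induction N with
  | zero => simpa using toOuterMeasure_le_one _ _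
  | succ N ih =>
    obtain hN | hN := Nat.lt_or_ge N b
    · rw [Nat.sub_eq_zero_of_le hN, pow_zero]
      exact toOuterMeasure_le_one _ _
    rw [loopRun_succ_toOuterMeasure]
    calc _ ≤ ∑' 𝒜, S.indicator (akpwRun P G l δ N) 𝒜 * r := by
          refine ENNReal.tsum_le_tsum fun 𝒜 => ?_
          by_cases h𝒜 : 𝒜 ∈ S
          · have hd : ¬ akpwDone G 𝒜 := fun h => h𝒜 (joined_of_akpwDone h hb.1)
            rw [Set.indicator_of_mem h𝒜, if_neg hd]
            by_cases hsupp : 𝒜 ∈ (akpwRun P G l δ N).support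
            · have hlen := (akpwRun_length hsupp).resolve_right fun h => hd h.1
              gcongr
              rw [akpwStep, PMF.toOuterMeasure_map_apply, hlen, Nat.add_sub_cancel]
              simpa [hS] using akpw_round_cut_le hP hC hδ hb hN h𝒜
            · simp [(PMF.apply_eq_zero_iff _ _).2 hsupp]
          · have hj : Joined G (𝒜.getLastD ∅) e := not_not.1 h𝒜
            have h0 : (open Classical in if akpwDone G 𝒜 then PMF.pure 𝒜
                else akpwStep P G l δ 𝒜).toOuterMeasure S = 0 := by
              split_ifs with hd
              · simp [h𝒜]
              · rw [akpwStep, PMF.toOuterMeasure_map_apply]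
                have : (fun T => 𝒜 ++ [𝒜.getLastD ∅ ∪ T]) ⁻¹' S = ∅ := by
                  refine Set.eq_empty_of_forall_notMem fun T hT => hT ?_
                  simpa using hj.mono Set.subset_union_left
                rw [this, MeasureTheory.measure_empty]
            rw [h0, mul_zero]
            exact zero_le
      _ = (akpwRun P G l δ N).toOuterMeasure S * r := by
          rw [ENNReal.tsum_mul_right, PMF.toOuterMeasure_apply]
      _ ≤ r ^ (N - b) * r := by gcongr
      _ = r ^ (N + 1 - b) := by rw [← pow_succ, Nat.sub_add_comm hN]

theorem akpwLevel_natCast_of_length_le {𝒜 : List (Set E)} {j : ℕ} (h : 𝒜.length ≤ j + 1)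
    (hne : 𝒜 ≠ []) : akpwLevel 𝒜 j = 𝒜.getLastD ∅ := by
  have hpos := List.length_pos_iff.2 hne
  rw [akpwLevel, if_neg (by simp), Int.toNat_natCast]
  obtain h | h := Nat.lt_or_ge j 𝒜.length
  · have : j = 𝒜.length - 1 := by omega
    rw [List.getD_eq_getElem _ _ h, List.getLastD_eq_getLast?, List.getLast?_eq_getElem?, ← this]
    simp [h]
  · exact List.getD_eq_default _ _ h

theorem akpwLevel_append {𝒜 : List (Set E)} {j : ℕ} (h : j < 𝒜.length) (B : Set E) :
    akpwLevel (𝒜 ++ [B]) j = akpwLevel 𝒜 j := by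
  rw [akpwLevel, akpwLevel, if_neg (by simp), if_neg (by simp), Int.toNat_natCast,
    List.getD_append _ _ _ _ h, List.getD_eq_getElem _ _ h, List.getD_eq_getElem _ _ h]

/-- After `A_j` has been built, later rounds do not change it, and a run that stops earlier has
joined everything. -/
theorem akpwRun_level_le [Finite V] (hP : IsPartitionRoutine C k P) (hC : 0 < C)
    (hδ : 0 < δ) {b : ℕ}
    (hb : e ∈ bucket G l δ b) (j : ℕ) {N : ℕ} (hN : j ≤ N) :
    (akpwRun P G l δ N).toOuterMeasure {𝒜 | ¬ Joined G (akpwLevel 𝒜 j) e} ≤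
      ENNReal.ofReal (3 * C * logn G / δ) ^ (j - b) := by
  set S : Set (List (Set E)) := {𝒜 | ¬ Joined G (akpwLevel 𝒜 j) e} with hS
  induction N, hN using Nat.le_induction with
  | base =>
    refine le_trans (PMF.toOuterMeasure_mono _ ?_) (akpwRun_last_le hP hC hδ hb j)
    rintro 𝒜 ⟨h𝒜, hsupp⟩
    have : 𝒜.length ≤ j + 1 ∧ 𝒜 ≠ [] := by
      obtain h | h := akpwRun_length hsupp
      · exact ⟨h.le, by rintro rfl; simp at h⟩
      · exact ⟨h.2.2, h.2.1⟩
    rwa [Set.mem_ofPred_eq, ← akpwLevel_natCast_of_length_le this.1 this.2]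
  | succ N hN ih =>
    refine le_trans ?_ ih
    rw [loopRun_succ_toOuterMeasure, PMF.toOuterMeasure_apply]
    refine ENNReal.tsum_le_tsum fun 𝒜 => ?_
    by_cases hd : akpwDone G 𝒜
    · rw [if_pos hd, PMF.toOuterMeasure_pure_apply]
      by_cases h : 𝒜 ∈ S <;> simp [h]
    · rw [if_neg hd]
      by_cases hsupp : 𝒜 ∈ (akpwRun P G l δ N).support
      · have hlen := (akpwRun_length hsupp).resolve_right fun h => hd h.1
        by_cases h : 𝒜 ∈ S
        · rw [Set.indicator_of_mem h]
          exact mul_le_of_le_one_right' (toOuterMeasure_le_one _ _)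
        · have : (akpwStep P G l δ 𝒜).toOuterMeasure S = 0 := by
            rw [akpwStep, PMF.toOuterMeasure_map_apply]
            have : (fun T => 𝒜 ++ [𝒜.getLastD ∅ ∪ T]) ⁻¹' S = ∅ := by
              refine Set.eq_empty_of_forall_notMem fun T hT => h ?_
              rwa [Set.mem_preimage, hS, Set.mem_ofPred_eq, akpwLevel_append (by omega)] at hT
            rw [this, MeasureTheory.measure_empty]
          rw [this, mul_zero]
          exact zero_le
      · simp [(PMF.apply_eq_zero_iff _ _).2 hsupp]

theorem prob_akpwLevel_le [Finite V] (hP : IsPartitionRoutine C k P) (hC : 0 < C)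
    (hδ : 0 < δ) {b : ℕ}
    (hb : e ∈ bucket G l δ b) (j : ℕ) :
    prob (akpwLaw P G l δ) {𝒜 | ¬ Joined G (akpwLevel 𝒜 j) e} ≤
      ENNReal.ofReal (3 * C * logn G / δ) ^ (j - b) :=
  prob_loopLaw_le (N₀ := j) fun _ hN => akpwRun_level_le hP hC hδ hb j hN

theorem exists_mem_bucket (hδ : 1 < δ) (hl : ∀ e ∈ G.edgeSet, 1 ≤ l e) (he : e ∈ G.edgeSet) :
    ∃ b, e ∈ bucket G l δ b := by
  obtain ⟨b, h⟩ := exists_nat_pow_near (hl e he) hδ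
  exact ⟨b, he, h⟩

theorem akpwDone_of_forall_joined (hG : IsInput G l) {𝒜 : List (Set E)}
    (h : ∀ e ∈ G.edgeSet, Joined G (𝒜.getLastD ∅) e) : akpwDone G 𝒜 := by
  intro x hx y hy
  have hxy := hG.connected x hx y hy
  clear hy
  induction hxy with
  | refl => exact .refl
  | tail _ h' ih =>
    obtain ⟨e, he⟩ := h'
    exact ih.trans ((joined_iff_conn he).1 (h e he.edge_mem))

/-- Every edge is joined after sufficiently many rounds, with probability tending to one. -/
theorem tsum_akpwLaw [Finite V] [Finite E] (hP : IsPartitionRoutine C k P) (hC : 0 < C) (hδ : 1 < δ)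
    (hr : 3 * C * logn G / δ < 1) (hG : IsInput G l) : ∑' 𝒜, akpwLaw P G l δ 𝒜 = 1 := by
  refine tsum_loopLaw_eq_one ?_
  have := Fintype.ofFinite E
  classical
  have hb : ∀ e, ∃ b, e ∈ G.edgeSet → e ∈ bucket G l δ b := fun e => by
    by_cases he : e ∈ G.edgeSet
    · obtain ⟨b, h⟩ := exists_mem_bucket hδ hG.one_le he
      exact ⟨b, fun _ => h⟩
    · exact ⟨0, fun h => absurd h he⟩
  choose b hb using hb
  set r := ENNReal.ofReal (3 * C * logn G / δ) with hr'
  have hr1 : r < 1 := by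
    rw [hr', ← ENNReal.ofReal_one]
    exact (ENNReal.ofReal_lt_ofReal_iff one_pos).2 hr
  have hle : ∀ N, (akpwRun P G l δ N).toOuterMeasure {𝒜 | ¬ akpwDone G 𝒜} ≤
      ∑ e : E, r ^ (N - b e) := by
    intro N
    calc _ ≤ (akpwRun P G l δ N).toOuterMeasure
            (⋃ e ∈ (Finset.univ.filter (· ∈ G.edgeSet)),
              {𝒜 | ¬ Joined G (𝒜.getLastD ∅) e}) := by
          refine MeasureTheory.measure_mono fun 𝒜 h𝒜 => ?_
          by_contra hcon
          refine h𝒜 (akpwDone_of_forall_joined hG fun e he => ?_)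
          by_contra hj
          exact hcon (by simp only [Set.mem_iUnion]; exact ⟨e, by simpa using he, hj⟩)
      _ ≤ ∑ e ∈ Finset.univ.filter (· ∈ G.edgeSet), r ^ (N - b e) :=
          (MeasureTheory.measure_biUnion_finset_le _ _).trans <| Finset.sum_le_sum fun e he =>
            akpwRun_last_le hP hC (zero_lt_one.trans hδ) (hb e (by simpa using he)) N
      _ ≤ _ := Finset.sum_le_sum_of_subset (Finset.filter_subset _ _)
  refine tendsto_of_tendsto_of_tendsto_of_le_of_le tendsto_const_nhds ?_ (fun _ => zero_le) hle
  rw [← Finset.sum_const_zero (s := (Finset.univ : Finset E))]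
  exact tendsto_finsetSum _ fun e _ =>
    (ENNReal.tendsto_pow_atTop_nhds_zero_of_lt_one hr1).comp (tendsto_sub_atTop_nat (b e))

end AKPW

/-! ### One pass of the second stage -/

section Pass

theorem mem_components {α : Type*} {β : Type*} [Finite α] {H : Graph α β} {X : Set α} :
    X ∈ components H ↔ ∃ x ∈ H.vertexSet, comp H x = X := by
  simp [components]

theorem subset_vertexSet_of_mem_components {α : Type*} {β : Type*} [Finite α] {H : Graph α β}
    {X : Set α} (hX : X ∈ components H) : X ⊆ H.vertexSet := by
  obtain ⟨x, hx, rfl⟩ := mem_components.1 hX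
  exact comp_subset_vertexSet hx

theorem joined_of_le {α : Type*} {β : Type*} {H K : Graph α β} {F : Set β} {e : β} (h : H ≤ K)
    (hj : Joined H F e) : Joined K F e := by
  obtain ⟨x, y, hxy, hc⟩ := hj
  exact ⟨x, y, h.isLink_mono hxy, Conn.mono (G := H.restrict F) (H := K.restrict F)
    (fun _ _ _ h' => ⟨h'.1, h.isLink_mono h'.2⟩) hc⟩

variable {α : Type*} {β : Type*} [Finite α] {H : Graph α β} {l : β → ℝ} {C d : ℝ} {k : ℕ}
  {P : PartitionRoutine α β} {e : β}

/-- Calling Partition on all components cuts an edge with the same probability bound as calling it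
on one graph, as only the call on the component of the edge matters. -/
theorem partitionAll_cut_le (hP : IsPartitionRoutine C k P) (hC : 0 < C) (hH : H.Loopless)
    (hl : ∀ e ∈ H.edgeSet, 0 < l e) (hd : 0 < d) (he : e ∈ H.edgeSet) :
    (partitionAll P H l d).toOuterMeasure {F | ¬ Joined H F e} ≤
      ENNReal.ofReal (C * l e * logn H / d) := by
  obtain ⟨x, y, hxy⟩ := Graph.exists_isLink_of_mem_edgeSet he
  set X := comp H x with hX
  have hXV : X ⊆ H.vertexSet := comp_subset_vertexSet hxy.left_mem
  have hXle : H.induce X ≤ H := Graph.induce_le hXV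
  have hXe : e ∈ (H.induce X).edgeSet :=
    ⟨x, y, hxy, .refl, (Relation.ReflTransGen.single ⟨e, hxy⟩ : Conn H x y)⟩
  have hcall : (P (H.induce X) l d).toOuterMeasure {T | ¬ Joined (H.induce X) T e} ≤
      ENNReal.ofReal (C * l e * logn H / d) := by
    refine (hP.cut _ _ _ (Graph.Loopless.anti hXle)
      (fun e he => hl e (Graph.IsSubgraph.edgeSet_mono hXle he)) hd e hXe).trans
        (ENNReal.ofReal_le_ofReal ?_)
    have := (hl e he).le
    gcongr
    exact logn_mono_of_ncard_le (Set.ncard_le_ncard hXV (Set.toFinite _))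
  have hmem : X ∈ components H := mem_components.2 ⟨x, hxy.left_mem, rfl⟩
  rw [partitionAll]
  generalize components H = Xs at hmem
  induction Xs with
  | nil => simp at hmem
  | cons Y L ih =>
    rw [List.foldr_cons, PMF.toOuterMeasure_bind_apply]
    set law := L.foldr (fun X law => law.bind fun F => (P (H.induce X) l d).map fun T => F ∪ T)
      (PMF.pure ∅) with hlaw
    obtain rfl | hXL := List.mem_cons.1 hmem
    · calc _ ≤ ∑' F, law F * ENNReal.ofReal (C * l e * logn H / d) := by
            refine ENNReal.tsum_le_tsum fun F => mul_le_mul_right ?_ _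
            rw [PMF.toOuterMeasure_map_apply]
            refine le_trans (MeasureTheory.measure_mono ?_) hcall
            exact fun T hT h => hT ((joined_of_le hXle h).mono Set.subset_union_right)
        _ = _ := by rw [ENNReal.tsum_mul_right, PMF.tsum_coe, one_mul]
    · refine le_trans ?_ (ih hXL)
      rw [PMF.toOuterMeasure_apply]
      refine ENNReal.tsum_le_tsum fun F => ?_
      rw [PMF.toOuterMeasure_map_apply]
      by_cases hF : Joined H F e
      · have : (fun T => F ∪ T) ⁻¹' {F | ¬ Joined H F e} = ∅ :=
          Set.eq_empty_of_forall_notMem fun T hT => hT (hF.mono Set.subset_union_left)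
        rw [this, MeasureTheory.measure_empty, mul_zero]
        exact zero_le
      · rw [Set.indicator_of_mem hF]
        exact mul_le_of_le_one_right' (toOuterMeasure_le_one _ _)

theorem subset_edgeSet_of_mem_support_partitionAll (hP : IsPartitionRoutine C k P)
    (hH : H.Loopless) (hl : ∀ e ∈ H.edgeSet, 0 < l e) (hd : 0 < d) {F : Set β}
    (hF : F ∈ (partitionAll P H l d).support) : F ⊆ H.edgeSet := by
  have hsub : ∀ X ∈ components H, X ⊆ H.vertexSet := fun X => subset_vertexSet_of_mem_components
  rw [partitionAll] at hF
  generalize components H = Xs at hsub hF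
  induction Xs generalizing F with
  | nil =>
    have : F = ∅ := by simpa using hF
    simp [this]
  | cons X L ih =>
    rw [List.foldr_cons, PMF.mem_support_bind_iff] at hF
    obtain ⟨F', hF', hF⟩ := hF
    obtain ⟨T, hT, rfl⟩ := (PMF.mem_support_map_iff _ _ _).1 hF
    have hle : H.induce X ≤ H := Graph.induce_le (hsub X (by simp))
    refine Set.union_subset (ih (fun Y hY => hsub Y (by simp [hY])) hF') ?_
    have := (hP.forest _ _ _ (Graph.Loopless.anti hle)
      (fun e he => hl e (Graph.IsSubgraph.edgeSet_mono hle he)) hd T hT).1.1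
    exact this.trans (Graph.IsSubgraph.edgeSet_mono hle)

end Pass

section TwoStagePass

variable {V : Type*} {E : Type*} {G : Graph V E} {l : E → ℝ} {C q δ D : ℝ} {k : ℕ}
  {P : PartitionRoutine (Set V) E} {e : E} {𝒜 : List (Set E)} {B : Set E}

theorem passGraph_le (A B : Set E) (s : ℤ) : passGraph G l δ A B s D ≤ contract G A :=
  Graph.restrict_le

theorem passGraph_loopless (A B : Set E) (s : ℤ) : (passGraph G l δ A B s D).Loopless :=
  loopless_of_le_contract (passGraph_le A B s) fun _ he => he.2.2.1

theorem raised_pos (hδ : 0 < δ) (s : ℤ) (e : E) : 0 < raised l δ s e :=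
  lt_max_of_lt_right (zpow_pos hδ _)

theorem pass_cut_eq_zero [Finite V] (he : Joined G (akpwLevel 𝒜 (scope q δ D)) e) :
    (pass P G l q δ 𝒜 B D).toOuterMeasure {F | Joined G B e ∧ ¬ Joined G F e} = 0 := by
  rw [pass, PMF.toOuterMeasure_map_apply]
  have : (fun F => akpwLevel 𝒜 (scope q δ D) ∪ F) ⁻¹' {F | Joined G B e ∧ ¬ Joined G F e} = ∅ :=
    Set.eq_empty_of_forall_notMem fun F hF => hF.2 (he.mono Set.subset_union_left)
  rw [this, MeasureTheory.measure_empty]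

theorem pass_cut_le [Finite V] (hP : IsPartitionRoutine C k P) (hC : 0 < C) (hδ : 0 < δ)
    (hD : 0 < D) (he : e ∈ G.edgeSet) (hr : raised l δ (scope q δ D) e < D / logn G) :
    (pass P G l q δ 𝒜 B D).toOuterMeasure {F | Joined G B e ∧ ¬ Joined G F e} ≤
      ENNReal.ofReal (3 * C * (raised l δ (scope q δ D) e * logn G / D)) := by
  by_cases hA : Joined G (akpwLevel 𝒜 (scope q δ D)) e
  · rw [pass_cut_eq_zero hA]
    exact zero_le
  by_cases hB : Joined G B e
  · set A := akpwLevel 𝒜 (scope q δ D) with hA'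
    set H := passGraph G l δ A B (scope q δ D) D with hH
    have hle : H ≤ contract G A := passGraph_le A B _
    rw [pass, PMF.toOuterMeasure_map_apply]
    calc _ ≤ (partitionAll P H (raised l δ (scope q δ D)) (D / 3)).toOuterMeasure
            {F | ¬ Joined H F e} := by
          refine MeasureTheory.measure_mono ?_
          exact fun F hF h => hF.2 (joined_union_of_joined_contract hle h)
      _ ≤ ENNReal.ofReal (C * raised l δ (scope q δ D) e * logn H / (D / 3)) :=
          partitionAll_cut_le hP hC (passGraph_loopless _ _ _) (fun _ _ => raised_pos hδ _ _)
            (by positivity) ⟨he, hB, hA, hr⟩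
      _ ≤ _ := by
          refine ENNReal.ofReal_le_ofReal ?_
          have h0 := raised_pos (l := l) hδ (scope q δ D) e
          calc C * raised l δ (scope q δ D) e * logn H / (D / 3) ≤
              C * raised l δ (scope q δ D) e * logn G / (D / 3) := by
                gcongr
                exact logn_le_of_le_contract hle
            _ = _ := by field_simp
  · have : {F : Set E | Joined G B e ∧ ¬ Joined G F e} = ∅ :=
      Set.eq_empty_of_forall_notMem fun F hF => hB hF.1
    rw [this, MeasureTheory.measure_empty]
    exact zero_le

/-- The set of exponents in the definition of `scope` is nonempty and bounded above, so that its
supremum belongs to it. -/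
theorem scope_spec (hδ : 1 < δ) (hD : 0 < D) :
    δ ^ ((scope q δ D : ℝ) + 1 / (1 - q) + 1) ≤ D := by
  have hδ0 : 0 < δ := zero_lt_one.trans hδ
  have hiff : ∀ j : ℤ, δ ^ ((j : ℝ) + 1 / (1 - q) + 1) ≤ D ↔
      (j : ℝ) ≤ Real.logb δ D - 1 - 1 / (1 - q) := fun j => by
    rw [← Real.le_logb_iff_rpow_le hδ hD]
    constructor <;> intro h <;> linarith
  refine Int.csSup_mem (s := {j : ℤ | δ ^ ((j : ℝ) + 1 / (1 - q) + 1) ≤ D}) ?_ ?_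
  · exact ⟨⌊Real.logb δ D - 1 - 1 / (1 - q)⌋, (hiff _).2 (Int.floor_le _)⟩
  · exact ⟨⌊Real.logb δ D - 1 - 1 / (1 - q)⌋, fun j hj => Int.le_floor.2 ((hiff j).1 hj)⟩

/-- In a pass of diameter less than one nothing is left to contract, and all edges are too long to
be kept. -/
theorem eq_empty_of_mem_support_pass [Finite V] (hP : IsPartitionRoutine C k P) (hq : q < 1)
    (hδ : 1 < δ) (hD : 0 < D) (hD1 : D < 1) (hlog : 1 ≤ logn G) (hl : ∀ e ∈ G.edgeSet, 1 ≤ l e)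
    {F : Set E} (hF : F ∈ (pass P G l q δ 𝒜 B D).support) : F = ∅ := by
  have hδ0 : 0 < δ := zero_lt_one.trans hδ
  have hscope : scope q δ D < 0 := by
    by_contra! h
    have h1 : (1 : ℝ) ≤ δ ^ ((scope q δ D : ℝ) + 1 / (1 - q) + 1) := by
      refine Real.one_le_rpow hδ.le ?_
      have : (0 : ℝ) ≤ scope q δ D := by exact_mod_cast h
      have : 0 < 1 - q := by linarith
      positivity
    linarith [scope_spec (q := q) hδ hD]
  obtain ⟨T, hT, rfl⟩ := (PMF.mem_support_map_iff _ _ _).1 hF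
  have hlevel : akpwLevel 𝒜 (scope q δ D) = ∅ := if_pos hscope
  have hsub := subset_edgeSet_of_mem_support_partitionAll hP (passGraph_loopless _ _ _)
    (fun _ _ => raised_pos hδ0 _ _) (by positivity) hT
  rw [hlevel, Set.empty_union]
  refine Set.eq_empty_of_forall_notMem fun e he => ?_
  have h1 : raised l δ (scope q δ D) e < D / logn G := (hsub he).2.2.2
  have h2 : 1 ≤ raised l δ (scope q δ D) e := (hl e (hsub he).1).trans (le_max_left _ _)
  have h3 : D / logn G ≤ D := div_le_self hD.le hlog
  linarith

theorem not_joined_empty (hG : G.Loopless) (he : e ∈ G.edgeSet) : ¬ Joined G ∅ e := by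
  obtain ⟨x, y, hxy⟩ := Graph.exists_isLink_of_mem_edgeSet he
  rw [joined_iff_conn hxy]
  intro h
  have hy : y ∈ ({x} : Set V) :=
    Conn.mem_of_closed (G := G.restrict ∅)
      (fun _ _ _ h _ => absurd h.1 (Set.notMem_empty _)) h rfl
  exact hxy.ne hy.symm

end TwoStagePass

/-! ### The law of the decomposition -/

section Law

variable {V : Type*} {E : Type*} [Finite V] {G : Graph V E} {l : E → ℝ} {C q δ D : ℝ} {k : ℕ}
  {P : PartitionRoutine (Set V) E} {e : E} {𝒜 : List (Set E)} {d : ℕ → ℝ} {t : ℕ}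

theorem twoStage_zero_apply {ℬ : ℕ → Set E} (h : ℬ ∈ (twoStage P G l q δ d 𝒜 t).support) :
    ℬ 0 = 𝒜.getLastD ∅ := by
  induction t generalizing ℬ with
  | zero =>
    rw [twoStage, PMF.mem_support_pure_iff] at h
    simp [h]
  | succ t ih =>
    rw [twoStage, PMF.mem_support_bind_iff] at h
    obtain ⟨ℬ', h', h⟩ := h
    obtain ⟨F, -, rfl⟩ := (PMF.mem_support_map_iff _ _ _).1 h
    simpa using ih h'

theorem twoStage_succ_apply {ℬ : ℕ → Set E}
    (h : ℬ ∈ (twoStage P G l q δ d 𝒜 (t + 1)).support) :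
    ∃ B, ℬ (t + 1) ∈ (pass P G l q δ 𝒜 B (d (t + 1))).support := by
  rw [twoStage, PMF.mem_support_bind_iff] at h
  obtain ⟨ℬ', h', h⟩ := h
  obtain ⟨F, hF, rfl⟩ := (PMF.mem_support_map_iff _ _ _).1 h
  exact ⟨ℬ' t, by simpa using hF⟩

/-- Later passes do not change `B_i` and `B_{i+1}`, so a bound for one pass, uniform in the
previous forest, carries over to the law of the whole sequence. -/
theorem twoStage_firstCutAt_le {i : ℕ} (hi : i < t) {x : ℝ≥0∞}
    (h : ∀ B, (pass P G l q δ 𝒜 B (d (i + 1))).toOuterMeasure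
      {F | Joined G B e ∧ ¬ Joined G F e} ≤ x) :
    (twoStage P G l q δ d 𝒜 t).toOuterMeasure {ℬ | FirstCutAt G ℬ i e} ≤ x := by
  induction t, hi using Nat.le_induction with
  | base =>
    rw [twoStage, PMF.toOuterMeasure_bind_apply]
    calc _ ≤ ∑' ℬ, twoStage P G l q δ d 𝒜 i ℬ * x := by
          refine ENNReal.tsum_le_tsum fun ℬ => mul_le_mul_right ?_ _
          rw [PMF.toOuterMeasure_map_apply]
          convert h (ℬ i) using 2
          ext F
          simp [FirstCutAt]
      _ = x := by rw [ENNReal.tsum_mul_right, PMF.tsum_coe, one_mul]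
  | succ t hit ih =>
    refine le_trans ?_ ih
    rw [twoStage, PMF.toOuterMeasure_bind_apply, PMF.toOuterMeasure_apply]
    refine ENNReal.tsum_le_tsum fun ℬ => ?_
    have hi : i ≠ t + 1 := by omega
    have hi' : i + 1 ≠ t + 1 := by omega
    by_cases hℬ : FirstCutAt G ℬ i e
    · rw [Set.indicator_of_mem (show ℬ ∈ {ℬ | FirstCutAt G ℬ i e} from hℬ)]
      exact mul_le_of_le_one_right' (toOuterMeasure_le_one _ _)
    · have : (fun F => Function.update ℬ (t + 1) F) ⁻¹' {ℬ | FirstCutAt G ℬ i e} = ∅ := by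
        refine Set.eq_empty_of_forall_notMem fun F hF => hℬ ?_
        simpa only [Set.mem_preimage, Set.mem_ofPred_eq, FirstCutAt, Function.update_of_ne hi,
          Function.update_of_ne hi'] using hF
      rw [PMF.toOuterMeasure_map_apply, this, MeasureTheory.measure_empty, mul_zero]
      exact zero_le

theorem prob_decomposeLaw (S : Set (ℕ → Set E)) :
    prob (decomposeLaw P G l q δ d t) S =
      ∑' 𝒜, akpwLaw P G l δ 𝒜 * (twoStage P G l q δ d 𝒜 t).toOuterMeasure S := by
  simp_rw [prob, PMF.toOuterMeasure_apply, ← ENNReal.tsum_mul_left]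
  rw [ENNReal.tsum_comm]
  refine tsum_congr fun ℬ => ?_
  by_cases h : ℬ ∈ S <;> simp [h, decomposeLaw]

theorem tsum_decomposeLaw :
    ∑' ℬ, decomposeLaw P G l q δ d t ℬ = ∑' 𝒜, akpwLaw P G l δ 𝒜 := by
  have := prob_decomposeLaw (P := P) (G := G) (l := l) (q := q) (δ := δ) (d := d) (t := t) Set.univ
  simpa [prob, PMF.toOuterMeasure_apply] using this

/-- Almost surely the ends of an edge are joined at first and separated at last, so that the edge is
cut in some pass. -/
theorem exists_firstCutAt (hP : IsPartitionRoutine C k P) (hG : IsInput G l) (hq : q < 1)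
    (hδ : 1 < δ) (hd : 0 < d t) (hd1 : d t < 1) (ht : 0 < t) (he : e ∈ G.edgeSet)
    {ℬ : ℕ → Set E} (h : decomposeLaw P G l q δ d t ℬ ≠ 0) : ∃ i < t, FirstCutAt G ℬ i e := by
  obtain ⟨𝒜, h𝒜⟩ : ∃ 𝒜, akpwLaw P G l δ 𝒜 * twoStage P G l q δ d 𝒜 t ℬ ≠ 0 := by
    by_contra! hcon
    exact h (by simp [decomposeLaw, hcon])
  have hdone : akpwDone G 𝒜 := halt_of_loopLaw_ne_zero (left_ne_zero_of_mul h𝒜)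
  have hsupp : ℬ ∈ (twoStage P G l q δ d 𝒜 t).support := right_ne_zero_of_mul h𝒜
  have h0 : Joined G (ℬ 0) e := twoStage_zero_apply hsupp ▸ joined_of_akpwDone hdone he
  have ht' : ¬ Joined G (ℬ t) e := by
    obtain ⟨s, rfl⟩ := Nat.exists_eq_succ_of_ne_zero ht.ne'
    obtain ⟨B, hB⟩ := twoStage_succ_apply hsupp
    have := hG.loopless
    rw [eq_empty_of_mem_support_pass hP hq hδ hd hd1 (one_le_logn hG.loopless he) hG.one_le hB]
    exact not_joined_empty hG.loopless he
  by_contra! hcon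
  have hall : ∀ i ≤ t, Joined G (ℬ i) e := by
    intro i hi
    induction i with
    | zero => exact h0
    | succ i ih => exact not_not.1 fun hj => hcon i hi ⟨ih (by omega), hj⟩
  exact ht' (hall t le_rfl)

end Law

/-! ### Real inequalities -/

/-- The trade-off between the two stages. An edge of length about `δ ^ b` in a pass with scope `j`
has its length raised to `δ ^ (j + 1)`, which by the choice of the scope is worth only the power `q`
of the relative length that was given up; survival of the `j - b` rounds of AKPW in between pays
for the rest. -/
theorem scope_tradeoff {δ q L D ℓ r : ℝ} {b j : ℕ} (hδ : 1 < δ) (hq0 : 0 < q) (hq1 : q < 1)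
    (hL : 1 ≤ L) (hLδ : L ≤ δ ^ (1 - q)) (hD : δ ^ ((j : ℝ) + 1 / (1 - q) + 1) ≤ D)
    (hb : δ ^ b ≤ ℓ) (hbj : b ≤ j) (hr0 : 0 ≤ r) (hr : r ≤ δ ^ (-q)) :
    δ ^ (j + 1) * L / D < 1 ∧ r ^ (j - b) * (δ ^ (j + 1) * L / D) ≤ (ℓ * L / D) ^ q := by
  have hδ0 : 0 < δ := zero_lt_one.trans hδ
  have hD0 : 0 < D := (Real.rpow_pos_of_pos hδ0 _).trans_le hD
  have h1q : 0 < 1 - q := by linarith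
  set y := δ ^ (j + 1) * L / D with hy
  have hy0 : 0 < y := by positivity
  have hyle : y ≤ δ ^ (-(1 / (1 - q))) * L := by
    rw [hy, div_le_iff₀ hD0]
    calc δ ^ (j + 1) * L = δ ^ (-(1 / (1 - q))) * L * δ ^ ((j : ℝ) + 1 / (1 - q) + 1) := by
          rw [mul_right_comm, ← Real.rpow_add hδ0, ← Real.rpow_natCast]
          congr 2
          push_cast
          ring
      _ ≤ _ := by gcongr
  have hypow : y ^ (1 - q) ≤ δ ^ (-q) := by
    calc y ^ (1 - q) ≤ (δ ^ (-(1 / (1 - q))) * L) ^ (1 - q) := by gcongr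
      _ = δ ^ (-1 : ℝ) * L ^ (1 - q) := by
          rw [Real.mul_rpow (by positivity) (by positivity), ← Real.rpow_mul hδ0.le]
          congr 2
          field_simp
      _ ≤ δ ^ (-1 : ℝ) * L ^ (1 : ℝ) := by gcongr; linarith
      _ ≤ δ ^ (-1 : ℝ) * δ ^ (1 - q) := by rw [Real.rpow_one]; gcongr
      _ = δ ^ (-q) := by rw [← Real.rpow_add hδ0]; congr 1; ring
  refine ⟨?_, ?_⟩
  · by_contra! h
    have h1 : 1 ≤ y ^ (1 - q) := Real.one_le_rpow h h1q.le
    have h2 : δ ^ (-q) < 1 := Real.rpow_lt_one_of_one_lt_of_neg hδ (by linarith)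
    linarith
  · have hcast : ((j - b : ℕ) : ℝ) = (j : ℝ) - b := Nat.cast_sub hbj
    calc r ^ (j - b) * y = r ^ (j - b) * (y ^ (1 - q) * y ^ q) := by
          rw [← Real.rpow_add hy0]; simp
      _ ≤ (δ ^ (-q)) ^ (j - b) * (δ ^ (-q) * y ^ q) := by gcongr
      _ = (δ ^ (-((j : ℝ) - b + 1))) ^ q * y ^ q := by
          rw [← mul_assoc, ← pow_succ, ← Real.rpow_natCast, ← Real.rpow_mul hδ0.le,
            ← Real.rpow_mul hδ0.le]
          push_cast
          rw [hcast]
          congr 2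
          ring
      _ = (δ ^ b * L / D) ^ q := by
          rw [← Real.mul_rpow (by positivity) hy0.le, hy, mul_div_assoc, mul_div_assoc, ← mul_assoc,
            ← Real.rpow_natCast, ← Real.rpow_natCast, ← Real.rpow_add hδ0]
          congr 3
          push_cast
          ring
      _ ≤ _ := by gcongr

/-- A lower bound on `δ` with `c = 6 C + 2` makes the chance that a round of AKPW misses an edge at
most `δ ^ (-q)`. -/
theorem delta_bounds {C L q δ : ℝ} (hC : 0 < C) (hL : 1 ≤ L) (hq0 : 0 < q) (hq1 : q < 1)
    (hδ : ((6 * C + 2) * L) ^ (1 / (1 - q)) ≤ δ) :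
    1 < δ ∧ L ≤ δ ^ (1 - q) ∧ 3 * C * L / δ ≤ δ ^ (-q) ∧ 3 * C * L / δ < 1 := by
  have h1q : 0 < 1 - q := by linarith
  have hc : 2 ≤ (6 * C + 2) * L := by nlinarith [mul_nonneg hC.le (zero_le_one.trans hL)]
  have hcL : (6 * C + 2) * L ≤ δ ^ (1 - q) := by
    calc (6 * C + 2) * L = (((6 * C + 2) * L) ^ (1 / (1 - q))) ^ (1 - q) := by
          rw [← Real.rpow_mul (by linarith), one_div, inv_mul_cancel₀ h1q.ne', Real.rpow_one]
      _ ≤ _ := by gcongr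
  have hδ1 : 1 < δ :=
    (Real.one_lt_rpow (by linarith : 1 < (6 * C + 2) * L) (by positivity)).trans_le hδ
  have hδ0 : 0 < δ := zero_lt_one.trans hδ1
  have hCL : 0 < C * L := by positivity
  have h3 : 3 * C * L / δ ≤ δ ^ (-q) := by
    rw [div_le_iff₀ hδ0]
    calc 3 * C * L ≤ δ ^ (1 - q) := by linarith
      _ = δ ^ (-q) * δ := by
          nth_rewrite 3 [← Real.rpow_one δ]
          rw [← Real.rpow_add hδ0]
          congr 1
          ring
  exact ⟨hδ1, by linarith, h3,
    h3.trans_lt (Real.rpow_lt_one_of_one_lt_of_neg hδ1 (by linarith))⟩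

/-- The terms increase geometrically with `i`, and the largest one is at most one. -/
theorem sum_rpow_div_le {d : ℕ → ℝ} {t : ℕ} {M γ s : ℝ} (hM : 0 < M) (hγ0 : 0 < γ) (hγ1 : γ < 1)
    (hs : 0 < s) (hd : ∀ i ≤ t, 0 < d i) (hdγ : ∀ i < t, d (i + 1) ≤ γ * d i) :
    ∑ i ∈ Finset.range t with M < d (i + 1), (M / d (i + 1)) ^ s ≤ 1 / (1 - γ ^ s) := by
  have hγs : γ ^ s < 1 := Real.rpow_lt_one hγ0.le hγ1 hs
  have hγs0 : 0 < γ ^ s := Real.rpow_pos_of_pos hγ0 s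
  set W := 1 / (1 - γ ^ s) with hW
  have hW0 : 0 < W := one_div_pos.2 (by linarith)
  have hWeq : W * γ ^ s + 1 = W := by
    have : 1 - γ ^ s ≠ 0 := by linarith
    rw [hW]
    field_simp
    ring
  -- as long as the diameters exceed `M`, the last term dominates the partial sum
  have key : ∀ m ≤ t, ∑ i ∈ Finset.range m with M < d (i + 1), (M / d (i + 1)) ^ s ≤ W ∧
      (M < d m → ∑ i ∈ Finset.range m with M < d (i + 1), (M / d (i + 1)) ^ s ≤
        W * (M / d m) ^ s) := by
    intro m hm
    induction m with
    | zero =>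
      have := hd 0 hm
      simp only [Finset.range_zero, Finset.filter_empty, Finset.sum_empty]
      exact ⟨hW0.le, fun _ => by positivity⟩
    | succ m ih =>
      obtain ⟨ih1, ih2⟩ := ih (by omega)
      have hdm := hd m (by omega)
      have hdm1 := hd (m + 1) hm
      have hratio := hdγ m (by omega)
      rw [Finset.range_add_one, Finset.filter_insert]
      split_ifs with h
      · rw [Finset.sum_insert (by simp)]
        have hMd : M < d m := by nlinarith
        have hz : (M / d m) ^ s ≤ γ ^ s * (M / d (m + 1)) ^ s := by
          rw [← Real.mul_rpow hγ0.le (by positivity)]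
          refine Real.rpow_le_rpow (by positivity) ?_ hs.le
          rw [div_le_iff₀ hdm, mul_assoc, div_mul_eq_mul_div, mul_div_assoc', le_div_iff₀ hdm1]
          nlinarith
        have hle : (M / d (m + 1)) ^ s + ∑ i ∈ Finset.range m with M < d (i + 1),
            (M / d (i + 1)) ^ s ≤ W * (M / d (m + 1)) ^ s := by
          calc _ ≤ (M / d (m + 1)) ^ s + W * (γ ^ s * (M / d (m + 1)) ^ s) := by
                gcongr
                exact (ih2 hMd).trans (by gcongr)
            _ = (W * γ ^ s + 1) * (M / d (m + 1)) ^ s := by ring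
            _ = _ := by rw [hWeq]
        refine ⟨hle.trans (mul_le_of_le_one_right hW0.le ?_), fun _ => hle⟩
        exact Real.rpow_le_one (by positivity) ((div_le_one hdm1).2 h.le) hs.le
      · exact ⟨ih1, fun h' => absurd h' h⟩
  exact (key t le_rfl).1

theorem one_div_one_sub_rpow_le {γ s : ℝ} (hγ0 : 0 < γ) (hγ1 : γ < 1) (hs0 : 0 < s) (hs1 : s ≤ 1) :
    1 / (1 - γ ^ s) ≤ 1 / (s * (1 - γ)) := by
  have h := rpow_one_add_le_one_add_mul_self (s := γ - 1) (by linarith) hs0.le hs1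
  rw [add_sub_cancel] at h
  have h0 : 0 < s * (1 - γ) := mul_pos hs0 (by linarith)
  exact one_div_le_one_div_of_le h0 (by linarith)

/-! ### Cut probabilities and expected stretch -/

section Main

variable {V : Type*} {E : Type*} {G : Graph V E} {l : E → ℝ} {C q δ : ℝ}
  {k : ℕ} {P : PartitionRoutine (Set V) E} {e : E} {d : ℕ → ℝ} {t : ℕ}

theorem tsum_decomposeLaw_eq_one [Finite V] [Finite E] (hP : IsPartitionRoutine C k P) (hC : 0 < C)
    (hG : IsInput G l) (hq0 : 0 < q) (hq1 : q < 1)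
    (hδ : ((6 * C + 2) * logn G) ^ (1 / (1 - q)) ≤ δ) (he : e ∈ G.edgeSet) :
    ∑' ℬ, decomposeLaw P G l q δ d t ℬ = 1 := by
  obtain ⟨hδ1, -, -, hr1⟩ := delta_bounds hC (one_le_logn hG.loopless he) hq0 hq1 hδ
  rw [tsum_decomposeLaw, tsum_akpwLaw hP hC hδ1 hr1 hG]

theorem prob_firstCutAt_le [Finite V] [Finite E] (hP : IsPartitionRoutine C k P) (hC : 0 < C)
    (hG : IsInput G l) (hq0 : 0 < q) (hq1 : q < 1)
    (hδ : ((6 * C + 2) * logn G) ^ (1 / (1 - q)) ≤ δ) (he : e ∈ G.edgeSet) {i : ℕ} (hi : i < t)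
    (hd : 0 < d (i + 1)) :
    prob (decomposeLaw P G l q δ d t) {ℬ | FirstCutAt G ℬ i e} ≤
      ENNReal.ofReal ((3 * C + 1) * (l e * logn G / d (i + 1)) ^ q) := by
  have hL : 1 ≤ logn G := one_le_logn hG.loopless he
  have hL0 : 0 < logn G := zero_lt_one.trans_le hL
  obtain ⟨hδ1, hLδ, hr, hr1⟩ := delta_bounds hC hL hq0 hq1 hδ
  have hδ0 : 0 < δ := zero_lt_one.trans hδ1
  have hle1 := hG.one_le e he
  have hle0 : 0 < l e := zero_lt_one.trans_le hle1
  set D := d (i + 1) with hD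
  set x := l e * logn G / D with hx
  have hx0 : 0 < x := by positivity
  have hxq0 : 0 < x ^ q := Real.rpow_pos_of_pos hx0 q
  rw [prob_decomposeLaw]
  obtain hlong | hshort := le_or_gt (δ ^ (scope q δ D + 1)) (l e)
  · -- the length is not raised, and the first stage is not needed
    have hraised : raised l δ (scope q δ D) e = l e := max_eq_left hlong
    have hpass : ∀ 𝒜 B, (pass P G l q δ 𝒜 B D).toOuterMeasure
        {F | Joined G B e ∧ ¬ Joined G F e} ≤ ENNReal.ofReal ((3 * C + 1) * x ^ q) := by
      intro 𝒜 B
      obtain hx1 | hx1 := lt_or_ge x 1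
      · refine (pass_cut_le hP hC hδ0 hd he ?_).trans (ENNReal.ofReal_le_ofReal ?_)
        · rw [hraised, lt_div_iff₀ hL0]
          exact (div_lt_one hd).1 hx1
        · rw [hraised]
          have : x ≤ x ^ q := by
            simpa using Real.rpow_le_rpow_of_exponent_ge hx0 hx1.le hq1.le
          exact mul_le_mul (by linarith) this hx0.le (by positivity)
      · refine (toOuterMeasure_le_one _ _).trans ?_
        rw [← ENNReal.ofReal_one]
        refine ENNReal.ofReal_le_ofReal ?_
        have : 1 ≤ x ^ q := Real.one_le_rpow hx1 hq0.le
        nlinarith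
    calc _ ≤ ∑' 𝒜, akpwLaw P G l δ 𝒜 * ENNReal.ofReal ((3 * C + 1) * x ^ q) :=
          ENNReal.tsum_le_tsum fun 𝒜 => mul_le_mul_right (twoStage_firstCutAt_le hi (hpass 𝒜)) _
      _ = _ := by rw [ENNReal.tsum_mul_right, tsum_akpwLaw hP hC hδ1 hr1 hG, one_mul]
  · -- as lengths are at least one, only a nonnegative scope can raise one
    have hscope : 0 ≤ scope q δ D := by
      by_contra! h
      have : δ ^ (scope q δ D + 1) ≤ 1 := zpow_le_one_of_nonpos₀ hδ1.le (by omega)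
      linarith
    obtain ⟨j, hj⟩ := Int.eq_ofNat_of_zero_le hscope
    have hraised : raised l δ (scope q δ D) e = δ ^ (j + 1) := by
      rw [raised, max_eq_right hshort.le, hj]
      exact_mod_cast rfl
    obtain ⟨b, hb⟩ := exists_mem_bucket hδ1 hG.one_le he
    have hbj : b ≤ j := by
      have h1 : δ ^ (scope q δ D + 1) = δ ^ (j + 1) := by rw [hj]; exact_mod_cast rfl
      have : δ ^ b < δ ^ (j + 1) := hb.2.1.trans_lt (h1 ▸ hshort)
      exact Nat.lt_succ_iff.1 ((pow_lt_pow_iff_right₀ hδ1).1 this)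
    have hscD : δ ^ ((j : ℝ) + 1 / (1 - q) + 1) ≤ D := by
      have := scope_spec (q := q) hδ1 hd
      rw [hj] at this
      exact_mod_cast this
    have hr0 : 0 ≤ 3 * C * logn G / δ := by positivity
    obtain ⟨hy1, hy⟩ := scope_tradeoff hδ1 hq0 hq1 hL hLδ hscD hb.2.1 hbj hr0 hr
    set y := δ ^ (j + 1) * logn G / D with hy'
    have hy0 : 0 < y := by positivity
    calc _ ≤ ∑' 𝒜, {𝒜 | ¬ Joined G (akpwLevel 𝒜 j) e}.indicator (akpwLaw P G l δ) 𝒜 *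
            ENNReal.ofReal (3 * C * y) := by
          refine ENNReal.tsum_le_tsum fun 𝒜 => ?_
          by_cases h𝒜 : Joined G (akpwLevel 𝒜 j) e
          · have : (twoStage P G l q δ d 𝒜 t).toOuterMeasure {ℬ | FirstCutAt G ℬ i e} ≤ 0 :=
              twoStage_firstCutAt_le hi fun B => (pass_cut_eq_zero (by rwa [← hD, hj])).le
            rw [nonpos_iff_eq_zero.1 this, mul_zero]
            exact zero_le
          · rw [Set.indicator_of_mem (show 𝒜 ∈ {𝒜 | ¬ Joined G (akpwLevel 𝒜 j) e} from h𝒜)]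
            gcongr
            refine twoStage_firstCutAt_le hi fun B =>
              (pass_cut_le hP hC hδ0 hd he ?_).trans_eq ?_
            · rw [hraised, lt_div_iff₀ hL0]
              exact (div_lt_one hd).1 hy1
            · rw [hraised]
      _ = prob (akpwLaw P G l δ) {𝒜 | ¬ Joined G (akpwLevel 𝒜 j) e} *
            ENNReal.ofReal (3 * C * y) := by rw [ENNReal.tsum_mul_right, prob]
      _ ≤ ENNReal.ofReal (3 * C * logn G / δ) ^ (j - b) * ENNReal.ofReal (3 * C * y) := by
          gcongr
          exact prob_akpwLevel_le hP hC hδ0 hb j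
      _ = ENNReal.ofReal (3 * C * ((3 * C * logn G / δ) ^ (j - b) * y)) := by
          rw [← ENNReal.ofReal_pow hr0, ← ENNReal.ofReal_mul (by positivity)]
          congr 1
          ring
      _ ≤ _ := by
          refine ENNReal.ofReal_le_ofReal (mul_le_mul (by linarith) hy (by positivity) ?_)
          positivity

/-- An edge that is cut pays at most `log^p n` if the pass that cuts it has diameter at most
`l e * log n`, and otherwise what that pass charges. -/
theorem stretch_le_sum {p : ℝ} {ℬ : ℕ → Set E} (hp : 0 < p) (hl : 0 < l e)
    (hd : ∀ i ≤ t, 0 < d i) (h : ∃ i < t, FirstCutAt G ℬ i e) :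
    stretch G l p (fun i => d (i + 1)) t ℬ e ≤ ENNReal.ofReal (logn G ^ p) +
      ∑ i ∈ Finset.range t with l e * logn G < d (i + 1),
        {ℬ | FirstCutAt G ℬ i e}.indicator 1 ℬ * ENNReal.ofReal ((d (i + 1) / l e) ^ p) := by
  classical
  have h' : ∃ i, i < t ∧ FirstCutAt G ℬ i e := h
  obtain ⟨hi, hcut⟩ := Nat.find_spec h'
  rw [stretch, dif_pos h']
  set i := Nat.find h' with hidef
  have hdi := hd (i + 1) hi
  obtain hle | hlt := le_or_gt (d (i + 1)) (l e * logn G)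
  · refine le_add_right (ENNReal.ofReal_le_ofReal (Real.rpow_le_rpow (by positivity) ?_ hp.le))
    exact (div_le_iff₀' hl).2 hle
  · refine le_add_left ?_
    refine le_trans ?_ (Finset.single_le_sum (fun _ _ => zero_le)
      (Finset.mem_filter.2 ⟨Finset.mem_range.2 hi, hlt⟩))
    rw [Set.indicator_of_mem (show ℬ ∈ {ℬ | FirstCutAt G ℬ i e} from hcut)]
    simp

theorem expect_stretch_le [Finite V] [Finite E] {p γ : ℝ} (hP : IsPartitionRoutine C k P)
    (hC : 0 < C) (hG : IsInput G l) (hp0 : 0 < p) (hp1 : p < 1) (hq : q = (1 + p) / 2)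
    (hδ : ((6 * C + 2) * logn G) ^ (1 / (1 - q)) ≤ δ) (hγ0 : 0 < γ) (hγ1 : γ < 1)
    (hd : ∀ i ≤ t, 0 < d i) (hdγ : ∀ i < t, d (i + 1) ≤ γ * d i) (ht : 0 < t) (hdt : d t < 1)
    (he : e ∈ G.edgeSet) :
    expect (decomposeLaw P G l q δ d t) (fun ℬ => stretch G l p (fun i => d (i + 1)) t ℬ e) ≤
      ENNReal.ofReal ((1 + 2 * (3 * C + 1) / (1 - γ)) * (1 / (1 - p)) * logn G ^ p) := by
  have hq0 : 0 < q := by linarith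
  have hq1 : q < 1 := by linarith
  have hL : 1 ≤ logn G := one_le_logn hG.loopless he
  have hL0 : 0 < logn G := zero_lt_one.trans_le hL
  have hle0 : 0 < l e := zero_lt_one.trans_le (hG.one_le e he)
  have hδ1 := (delta_bounds hC hL hq0 hq1 hδ).1
  set μ := decomposeLaw P G l q δ d t with hμ
  set M := l e * logn G with hM
  have hM0 : 0 < M := by positivity
  set I := Finset.range t |>.filter (fun i => M < d (i + 1)) with hI
  have hsum : ∑ i ∈ I, (M / d (i + 1)) ^ ((1 - p) / 2) ≤ 2 / ((1 - γ) * (1 - p)) := by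
    refine (sum_rpow_div_le hM0 hγ0 hγ1 (by linarith) hd hdγ).trans ?_
    refine (one_div_one_sub_rpow_le hγ0 hγ1 (by linarith) (by linarith)).trans_eq ?_
    have h1 : 1 - γ ≠ 0 := by linarith
    have h2 : 1 - p ≠ 0 := by linarith
    field_simp
  have hterm : ∀ i ∈ I, prob μ {ℬ | FirstCutAt G ℬ i e} * ENNReal.ofReal ((d (i + 1) / l e) ^ p) ≤
      ENNReal.ofReal ((3 * C + 1) * logn G ^ p * (M / d (i + 1)) ^ ((1 - p) / 2)) := by
    intro i hi
    have hit : i < t := Finset.mem_range.1 (Finset.mem_filter.1 hi).1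
    have hdi := hd (i + 1) hit
    refine (mul_le_mul_left (prob_firstCutAt_le hP hC hG hq0 hq1 hδ he hit hdi) _).trans_eq ?_
    rw [← ENNReal.ofReal_mul (by positivity)]
    congr 1
    have hz0 : 0 < M / d (i + 1) := by positivity
    have hdl : d (i + 1) / l e = logn G * (M / d (i + 1))⁻¹ := by rw [hM]; field_simp
    rw [hdl, Real.mul_rpow hL0.le (by positivity), Real.inv_rpow hz0.le, ← Real.rpow_neg hz0.le]
    have hexp : (1 - p) / 2 = q + -p := by rw [hq]; ring
    rw [hexp, Real.rpow_add hz0]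
    ring
  calc expect μ (fun ℬ => stretch G l p (fun i => d (i + 1)) t ℬ e)
      ≤ ∑' ℬ, μ ℬ * (ENNReal.ofReal (logn G ^ p) + ∑ i ∈ I,
          {ℬ | FirstCutAt G ℬ i e}.indicator 1 ℬ * ENNReal.ofReal ((d (i + 1) / l e) ^ p)) := by
        refine ENNReal.tsum_le_tsum fun ℬ => ?_
        by_cases h0 : μ ℬ = 0
        · simp [h0]
        · gcongr
          exact stretch_le_sum hp0 hle0 hd
            (exists_firstCutAt hP hG hq1 hδ1 (hd t le_rfl) hdt ht he h0)
    _ = ENNReal.ofReal (logn G ^ p) + ∑ i ∈ I,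
          prob μ {ℬ | FirstCutAt G ℬ i e} * ENNReal.ofReal ((d (i + 1) / l e) ^ p) := by
        simp_rw [mul_add, ENNReal.tsum_add, Finset.mul_sum]
        rw [ENNReal.tsum_mul_right, tsum_decomposeLaw_eq_one hP hC hG hq0 hq1 hδ he, one_mul,
          Summable.tsum_finsetSum fun _ _ => ENNReal.summable]
        congr 1
        refine Finset.sum_congr rfl fun i _ => ?_
        simp_rw [← mul_assoc]
        rw [ENNReal.tsum_mul_right, prob]
        congr 2
        ext ℬ
        by_cases h : FirstCutAt G ℬ i e <;> simp [h]
    _ ≤ ENNReal.ofReal (logn G ^ p) + ∑ i ∈ I,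
          ENNReal.ofReal ((3 * C + 1) * logn G ^ p * (M / d (i + 1)) ^ ((1 - p) / 2)) := by
        gcongr with i hi
        exact hterm i hi
    _ = ENNReal.ofReal (logn G ^ p +
          (3 * C + 1) * logn G ^ p * ∑ i ∈ I, (M / d (i + 1)) ^ ((1 - p) / 2)) := by
        have hnn : ∀ i ∈ I, 0 ≤ (M / d (i + 1)) ^ ((1 - p) / 2) := fun i hi => by
          have := hd (i + 1) (Finset.mem_range.1 (Finset.mem_filter.1 hi).1)
          positivity
        have hS := Finset.sum_nonneg hnn
        rw [ENNReal.ofReal_add (by positivity) (by positivity), Finset.mul_sum,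
          ENNReal.ofReal_sum_of_nonneg fun i hi => by have := hnn i hi; positivity]
    _ ≤ _ := by
        refine ENNReal.ofReal_le_ofReal ?_
        have h1p : 0 < 1 - p := by linarith
        have h1γ : 0 < 1 - γ := by linarith
        calc _ ≤ logn G ^ p * (1 / (1 - p)) +
              (3 * C + 1) * logn G ^ p * (2 / ((1 - γ) * (1 - p))) := by
              gcongr
              refine le_mul_of_one_le_right (by positivity) ?_
              exact (one_le_div h1p).2 (by linarith)
          _ = _ := by field_simp

/-- Changing the diameter by a factor `ρ` costs at most `max 1 (1 / ρ)`, for every exponent in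
`[0, 1]`. -/
theorem rpow_div_pred_le {a D D' ρ q : ℝ} (ha : 0 ≤ a) (hD : 0 < D) (hD' : 0 < D') (hρ : 0 < ρ)
    (h : ρ * D ≤ D') (hq0 : 0 ≤ q) (hq1 : q ≤ 1) :
    (a / D') ^ q ≤ max 1 (1 / ρ) * (a / D) ^ q := by
  have hmax : 1 ≤ max 1 (1 / ρ) := le_max_left _ _
  calc (a / D') ^ q ≤ (1 / ρ * (a / D)) ^ q := by
        refine Real.rpow_le_rpow (by positivity) ?_ hq0
        rw [one_div_mul_eq_div, div_div, mul_comm D]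
        gcongr
    _ = (1 / ρ) ^ q * (a / D) ^ q := Real.mul_rpow (by positivity) (by positivity)
    _ ≤ max 1 (1 / ρ) ^ q * (a / D) ^ q := by gcongr; exact le_max_right _ _
    _ ≤ max 1 (1 / ρ) * (a / D) ^ q := by
        gcongr
        simpa using Real.rpow_le_rpow_of_exponent_le hmax hq1

theorem stretch_le_mul_stretch {p ρ : ℝ} {ℬ : ℕ → Set E} (hp0 : 0 ≤ p) (hp1 : p ≤ 1)
    (hl : 0 < l e) (hρ : 0 < ρ) (hd : ∀ i ≤ t, 0 < d i) (hdρ : ∀ i < t, ρ * d i ≤ d (i + 1)) :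
    stretch G l p d t ℬ e ≤
      ENNReal.ofReal (max 1 (1 / ρ)) * stretch G l p (fun i => d (i + 1)) t ℬ e := by
  classical
  have hpos : 0 < max 1 (1 / ρ) := lt_max_of_lt_left one_pos
  by_cases h : ∃ i, i < t ∧ FirstCutAt G ℬ i e
  · -- the bound for reciprocals, as the diameter is in the numerator here
    rw [stretch, dif_pos h, stretch, dif_pos h, ← ENNReal.ofReal_mul hpos.le]
    refine ENNReal.ofReal_le_ofReal ?_
    obtain ⟨hi, -⟩ := Nat.find_spec h
    set i := Nat.find h
    have h0 := hd i hi.le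
    have h1 := hd (i + 1) hi
    have := rpow_div_pred_le (a := 1) (D := (d (i + 1) / l e)⁻¹) (D' := (d i / l e)⁻¹) zero_le_one
      (by positivity) (by positivity) hρ (by
        rw [inv_div, inv_div, mul_div_assoc', div_le_div_iff₀ h1 h0]
        nlinarith [hdρ i hi]) hp0 hp1
    simpa using this
  · rw [stretch, dif_neg h, stretch, dif_neg h, ENNReal.mul_top (by simp)]

end Main

end TwoStage

end

theorem mainTheorem7 :
    -- the routine Partition exists, with an absolute constant
    (∀ k : ℕ, ∃ C : ℝ, 0 < C ∧ ∀ (α : Type u) (β : Type v) [Finite α] [Finite β],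
      ∃ P : TwoStage.PartitionRoutine α β, TwoStage.IsPartitionRoutine C k P) ∧
    -- the constant `c` depends only on the constant `C` of Partition
    ∀ C : ℝ, 0 < C → ∃ c : ℝ, 1 ≤ c ∧
      -- cut probabilities
      (∃ K : ℝ, 0 < K ∧ ∀ (V : Type u) (E : Type v) [Finite V] [Finite E]
        (k : ℕ) (P : TwoStage.PartitionRoutine (Set V) E) (G : Graph V E) (l : E → ℝ)
        (q δ : ℝ) (d : ℕ → ℝ) (t : ℕ),
        TwoStage.IsPartitionRoutine C k P → TwoStage.IsInput G l → 0 < q → q < 1 →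
        (c * TwoStage.logn G) ^ (1 / (1 - q)) ≤ δ → TwoStage.IsDiamSeq d t →
        ∀ e ∈ G.edgeSet,
          (∑' ℬ, TwoStage.decomposeLaw P G l q δ d t ℬ) = 1 ∧
          ∀ i < t,
            TwoStage.prob (TwoStage.decomposeLaw P G l q δ d t)
                {ℬ | TwoStage.FirstCutAt G ℬ i e} ≤
              ENNReal.ofReal (K * (l e * TwoStage.logn G / d (i + 1)) ^ q)) ∧
      -- expected stretch, each edge being charged with the diameter of the pass that cuts it
      (∀ γ : ℝ, 0 < γ → γ < 1 → ∃ K : ℝ, 0 < K ∧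
        ∀ (V : Type u) (E : Type v) [Finite V] [Finite E]
        (k : ℕ) (P : TwoStage.PartitionRoutine (Set V) E) (G : Graph V E) (l : E → ℝ)
        (p q δ : ℝ) (d : ℕ → ℝ) (t : ℕ),
        TwoStage.IsPartitionRoutine C k P → TwoStage.IsInput G l → 0 < p → p < 1 →
        q = (1 + p) / 2 → (c * TwoStage.logn G) ^ (1 / (1 - q)) ≤ δ → TwoStage.IsDiamSeq d t →
        (∀ i < t, d (i + 1) ≤ γ * d i) → 0 < t → d t < 1 →
        ∀ e ∈ G.edgeSet,
          TwoStage.expect (TwoStage.decomposeLaw P G l q δ d t)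
              (fun ℬ => TwoStage.stretch G l p (fun i => d (i + 1)) t ℬ e) ≤
            ENNReal.ofReal (K * (1 / (1 - p)) * TwoStage.logn G ^ p)) ∧
      -- both bounds with respect to the diameter of the last level at which the ends are together,
      -- for sequences whose consecutive ratios are bounded on both sides
      (∀ γ ρ : ℝ, 0 < γ → γ < 1 → 0 < ρ → ∃ K : ℝ, 0 < K ∧
        ∀ (V : Type u) (E : Type v) [Finite V] [Finite E]
        (k : ℕ) (P : TwoStage.PartitionRoutine (Set V) E) (G : Graph V E) (l : E → ℝ)
        (d : ℕ → ℝ) (t : ℕ),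
        TwoStage.IsPartitionRoutine C k P → TwoStage.IsInput G l → TwoStage.IsDiamSeq d t →
        (∀ i < t, ρ * d i ≤ d (i + 1) ∧ d (i + 1) ≤ γ * d i) →
        ∀ e ∈ G.edgeSet,
          (∀ q δ : ℝ, 0 < q → q < 1 → (c * TwoStage.logn G) ^ (1 / (1 - q)) ≤ δ →
            ∀ i < t,
              TwoStage.prob (TwoStage.decomposeLaw P G l q δ d t)
                  {ℬ | TwoStage.FirstCutAt G ℬ i e} ≤
                ENNReal.ofReal (K * (l e * TwoStage.logn G / d i) ^ q)) ∧
          (∀ p q δ : ℝ, 0 < p → p < 1 → q = (1 + p) / 2 →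
            (c * TwoStage.logn G) ^ (1 / (1 - q)) ≤ δ → 0 < t → d t < 1 →
              TwoStage.expect (TwoStage.decomposeLaw P G l q δ d t)
                  (fun ℬ => TwoStage.stretch G l p d t ℬ e) ≤
                ENNReal.ofReal (K * (1 / (1 - p)) * TwoStage.logn G ^ p))) := by
  refine ⟨fun k => ⟨8 * (k + 1), by positivity, fun α β _ _ =>
    TwoStage.exists_isPartitionRoutine k α β⟩, fun C hC => ⟨6 * C + 2, by linarith, ?_, ?_, ?_⟩⟩
  · refine ⟨3 * C + 1, by linarith, ?_⟩
    intro V E _ _ k P G l q δ d t hP hG hq0 hq1 hδ hd e he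
    exact ⟨TwoStage.tsum_decomposeLaw_eq_one hP hC hG hq0 hq1 hδ he, fun i hi =>
      TwoStage.prob_firstCutAt_le hP hC hG hq0 hq1 hδ he hi (hd.1 (i + 1) hi)⟩
  · intro γ hγ0 hγ1
    have h1γ : 0 < 1 - γ := by linarith
    refine ⟨1 + 2 * (3 * C + 1) / (1 - γ), by positivity, ?_⟩
    intro V E _ _ k P G l p q δ d t hP hG hp0 hp1 hq hδ hd hdγ ht hdt e he
    exact TwoStage.expect_stretch_le hP hC hG hp0 hp1 hq hδ hγ0 hγ1 hd.1 hdγ ht hdt he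
  · intro γ ρ hγ0 hγ1 hρ
    have h1γ : 0 < 1 - γ := by linarith
    set R := max 1 (1 / ρ) with hR
    have hR0 : 0 < R := lt_max_of_lt_left one_pos
    set K := 1 + 2 * (3 * C + 1) / (1 - γ) with hK
    have hK0 : 0 < K := by positivity
    have hK1 : 3 * C + 1 ≤ K := by
      have : 3 * C + 1 ≤ 2 * (3 * C + 1) / (1 - γ) := by
        rw [le_div_iff₀ h1γ]
        nlinarith
      linarith
    refine ⟨R * K, by positivity, ?_⟩
    intro V E _ _ k P G l d t hP hG hd hratio e he
    have hle0 : 0 < l e := zero_lt_one.trans_le (hG.one_le e he)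
    have hL := TwoStage.logn_nonneg G
    refine ⟨fun q δ hq0 hq1 hδ i hi => ?_, fun p q δ hp0 hp1 hq hδ ht hdt => ?_⟩
    · have hdi := hd.1 i hi.le
      have hdi1 := hd.1 (i + 1) hi
      refine (TwoStage.prob_firstCutAt_le hP hC hG hq0 hq1 hδ he hi hdi1).trans
        (ENNReal.ofReal_le_ofReal ?_)
      calc _ ≤ K * (R * (l e * TwoStage.logn G / d i) ^ q) := by
            gcongr
            exact TwoStage.rpow_div_pred_le (by positivity) hdi hdi1 hρ (hratio i hi).1 hq0.le
              hq1.le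
        _ = _ := by ring
    · calc _ ≤ TwoStage.expect (TwoStage.decomposeLaw P G l q δ d t) (fun ℬ =>
              ENNReal.ofReal R * TwoStage.stretch G l p (fun i => d (i + 1)) t ℬ e) :=
            ENNReal.tsum_le_tsum fun ℬ => mul_le_mul_right (TwoStage.stretch_le_mul_stretch hp0.le
              hp1.le hle0 hρ hd.1 fun i hi => (hratio i hi).1) _
        _ = ENNReal.ofReal R * TwoStage.expect (TwoStage.decomposeLaw P G l q δ d t)
              (fun ℬ => TwoStage.stretch G l p (fun i => d (i + 1)) t ℬ e) := by
            simp_rw [TwoStage.expect, mul_left_comm, ENNReal.tsum_mul_left]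
        _ ≤ ENNReal.ofReal R * ENNReal.ofReal (K * (1 / (1 - p)) * TwoStage.logn G ^ p) := by
            gcongr
            exact TwoStage.expect_stretch_le hP hC hG hp0 hp1 hq hδ hγ0 hγ1 hd.1
              (fun i hi => (hratio i hi).2) ht hdt he
        _ = _ := by
            rw [← ENNReal.ofReal_mul hR0.le]
            congr 1
            ring
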